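/- Let $|x|=\max_i|x_i|$ on $\mathbb{R}^d$ and let $\|\cdot\|$ be the Euclidean norm on $\mathbb{R}^p$. A sequence $(x_i)_{i\ge1}$ in $\mathbb{R}^d$ is called well-separated if $\inf_{i\neq j}|x_i-x_j|>0$. A function $k:\mathbb{R}^d\to\mathbb{R}$ is called a stationary covariance function if $(x,x')\mapsto k(x-x')$ is a covariance function. **Setting.** Let $Z$ be a zero-mean Gaussian process on $\mathbb{R}^d$ with stationary covariance function $k_Z$ such that * $|k_Z(s)|\le C e^{-c|s|}$ for all $s\in\mathbb{R}^d$, for some constants $C<\infty$, $c>0$; * for every well-separated sequence $(x_i)$, the smallest eigenvalue of $(k_Z(x_i-x_j))_{1\le i,j\le n}$ is bounded below by a positive constant not depending on $n$. Let $T:\mathbb{R}\to\mathbb{R}$ be a non-constant, non-decreasing, continuously differentiable function such that, for some $C<\infty$, $|T(t)|\le Ce^{C|t|}$ and $|T'(t)|\le Ce^{C|t|}$ for all $t$. Let $Y(s)=T(Z(s))$ and assume that $\mathbb{E}[Y(s)]=0$ for all $s\in\mathbb{R}^d$. Let $(s_i)_{i\ge 1}$ be a well-separated sequence of observation locations in $\mathbb{R}^d$,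 and let $y=(Y(s_1),\dots,Y(s_n))^\top$. **Model.** Let $\Theta\subset\mathbb{R}^p$ be compact and let $\{k_\theta:\theta\in\Theta\}$ be stationary covariance functions on $\mathbb{R}^d$. Assume: 1. (Smoothness) There are $C<\infty$, $c>0$ with $|k_\theta(s)|\le Ce^{-c|s|}$ for all $\theta\in\Theta$, $s\in\mathbb{R}^d$. Moreover there is an open set $U\supseteq\Theta$ to which, for every $s$, the function $\theta\mapsto k_\theta(s)$ extends as a three times continuously differentiable function, such that for some $C<\infty$, $c>0$, $$\left|\frac{\partial^\ell k_\theta(s)}{\partial\theta_{i_1}\cdots\partial\theta_{i_\ell}}\right|\le\frac{C}{1+|s|^{d+c}}\qquad\text{for all }\theta\in U,\ s\in\mathbb{R}^d,\ \ell\in\{1,2,3\},\ 1\le i_1,\dots,i_\ell\le p.$$ 2. (Fourier positivity) The Fourier transform $\hat k_\theta(f)=(2\pi)^{-d}\int_{\mathbb{R}^d}k_\theta(t)e^{-\mathrm{i}f^\top t}\,dt$ is jointly continuous in $(\theta,f)$ and strictly positive on $\Theta\times\mathbb{R}^d$. 3. (Well-specification) There is $\theta_0$ in the interior of $\Theta$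 such that $k_{\theta_0}$ is the covariance function of $Y$. 4. (Global identifiability) For every $\alpha>0$, $$\liminf_{n\to\infty}\ \inf_{\theta\in\Theta,\ \|\theta-\theta_0\|\ge\alpha}\ \frac1n\sum_{i,j=1}^n\bigl(k_\theta(s_i-s_j)-k_{\theta_0}(s_i-s_j)\bigr)^2>0,$$ where the infimum over the empty set is $+\infty$. **Conclusion.** For $n\ge1$ let $R_\theta=(k_\theta(s_i-s_j))_{1\le i,j\le n}$ and let the Gaussian maximum likelihood estimator $\hat\theta_{\mathrm{ML}}=\hat\theta_{\mathrm{ML},n}$ be, almost surely, any minimizer over $\theta\in\Theta$ of $$L_\theta=\frac1n\left(\log\det R_\theta+y^\top R_\theta^{-1}y\right).$$ Then $\hat\theta_{\mathrm{ML}}\to\theta_0$ in probability as $n\to\infty$. -/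

import Mathlib

open MeasureTheory ProbabilityTheory Filter Topology

/-- Spatial domain `ℝ^d`. Its norm `‖·‖` is the maximum norm `|x| = max_i |x_i|`, and its volume is
Lebesgue measure. -/
abbrev Space (d : ℕ) : Type := Fin d → ℝ

/-- Parameter space `ℝ^p` with the Euclidean norm. -/
abbrev Param (p : ℕ) : Type := EuclideanSpace ℝ (Fin p)

/-- The `n × n` matrix `(k (x_i - x_j))` built from the first `n` points of the sequence `x`. -/
def covMatrix {d : ℕ} (k : Space d → ℝ) (x : ℕ → Space d) (n : ℕ) : Matrix (Fin n) (Fin n) ℝ :=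
  Matrix.of fun i j => k (x i - x j)

/-- `k` is a stationary covariance function: `(x₁, x₂) ↦ k (x₁ - x₂)` is symmetric and positive
semidefinite. -/
def IsStationaryCovariance {d : ℕ} (k : Space d → ℝ) : Prop :=
  ∀ (n : ℕ) (x : ℕ → Space d), (covMatrix k x n).PosSemidef

/-- Asymptotically well-separated sequence of locations: `inf_{i ≠ j} |x_i - x_j| > 0`. -/
def WellSeparated {d : ℕ} (x : ℕ → Space d) : Prop :=
  ∃ δ : ℝ, 0 < δ ∧ ∀ i j : ℕ, i ≠ j → δ ≤ ‖x i - x j‖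

/-- Sub-exponential and asymptotically positive stationary covariance function. The second field
says that the infimum over `n` of the smallest eigenvalue of `(k (x_i - x_j))_{i,j ≤ n}` is
positive, for every well-separated sequence. -/
structure SubExpAsympPos {d : ℕ} (k : Space d → ℝ) : Prop where
  decay : ∃ C c : ℝ, 0 < c ∧ ∀ s, |k s| ≤ C * Real.exp (-c * ‖s‖)
  asympPos : ∀ x : ℕ → Space d, WellSeparated x →
    ∃ c : ℝ, 0 < c ∧ ∀ (n : ℕ) (lam : ℝ),
      Module.End.HasEigenvalue (Matrix.toLin' (covMatrix k x n)) lam → c ≤ lam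

/-- Sub-exponential and non-decreasing transformation. -/
structure SubExpNondecreasing (F : ℝ → ℝ) : Prop where
  nonconstant : ¬ ∃ a, ∀ t, F t = a
  contDiff : ContDiff ℝ 1 F
  bound : ∃ C : ℝ, ∀ t, |F t| ≤ C * Real.exp (C * |t|) ∧ |deriv F t| ≤ C * Real.exp (C * |t|)
  monotone : Monotone F

/-- Fourier transform `(2π)^{-d} ∫ h(t) exp(-i fᵀ t) dt`. -/
noncomputable def fourierTransform {d : ℕ} (h : Space d → ℝ) (f : Space d) : ℂ :=
  (((2 * Real.pi) ^ d)⁻¹ : ℝ) * ∫ t : Space d, (h t : ℂ) * Complex.exp (-Complex.I * ((f ⬝ᵥ t : ℝ) : ℂ))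

/-- The random field `X` has mean zero. Only used for a Gaussian process `Z` and for `T ∘ Z` with `T`
sub-exponential; these have finite moments of all orders, so all expectations exist. -/
def ZeroMean {d : ℕ} {Ω : Type*} [MeasurableSpace Ω] (P : Measure Ω) (X : Space d → Ω → ℝ) : Prop :=
  ∀ s, ∫ ω, X s ω ∂P = 0

/-- The random field `X` has stationary covariance function `k`. Used for the same fields as
`ZeroMean`, so that all covariances exist. -/
def HasStationaryCovariance {d : ℕ} {Ω : Type*} [MeasurableSpace Ω] (P : Measure Ω)
    (X : Space d → Ω → ℝ) (k : Space d → ℝ) : Prop :=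
  ∀ s t, cov[X s, X t; P] = k (s - t)

/-- The transformed Gaussian process `Y(s) = T(Z(s))`. -/
def transformed {d : ℕ} {Ω : Type*} (T : ℝ → ℝ) (Z : Space d → Ω → ℝ) (s : Space d) (ω : Ω) : ℝ :=
  T (Z s ω)

/-- The setting for `Z`, `T`, `Y = T ∘ Z` and the locations. -/
structure TransformedGaussianSetting {d : ℕ} {Ω : Type*} [MeasurableSpace Ω] (P : Measure Ω)
    (Z : Space d → Ω → ℝ) (kZ : Space d → ℝ) (T : ℝ → ℝ) (s : ℕ → Space d) : Prop where
  gaussian : IsGaussianProcess Z P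
  zeroMean : ZeroMean P Z
  covariance : HasStationaryCovariance P Z kZ
  covarianceCond : SubExpAsympPos kZ
  transformation : SubExpNondecreasing T
  transformedZeroMean : ZeroMean P (transformed T Z)
  wellSeparated : WellSeparated s

/-- Partial derivative `∂^ℓ g / ∂θ_{i_1} ⋯ ∂θ_{i_ℓ}` at `θ`. -/
noncomputable def partialDeriv {p : ℕ} (g : Param p → ℝ) (l : ℕ) (i : Fin l → Fin p)
    (θ : Param p) : ℝ :=
  iteratedFDeriv ℝ l g θ fun m => EuclideanSpace.single (i m) 1

/-- Smoothness condition on the covariance model. The functions `θ ↦ k_θ(s)` are `C³` on an open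
neighbourhood `U` of `Θ`, the same for all `s`, and the bound on the derivatives holds on `U`; the
values of `k` at parameters outside `Θ` play no other role. -/
structure SmoothModel {d p : ℕ} (Θ : Set (Param p)) (k : Param p → Space d → ℝ) : Prop where
  decay : ∃ C c : ℝ, 0 < c ∧ ∀ θ ∈ Θ, ∀ s, |k θ s| ≤ C * Real.exp (-c * ‖s‖)
  smooth : ∃ U : Set (Param p), IsOpen U ∧ Θ ⊆ U ∧
    (∀ s, ContDiffOn ℝ 3 (fun θ => k θ s) U) ∧
    ∃ C c : ℝ, 0 < c ∧ ∀ θ ∈ U, ∀ s, ∀ l ∈ ({1, 2, 3} : Set ℕ), ∀ i : Fin l → Fin p,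
      |partialDeriv (fun η => k η s) l i θ| ≤ C / (1 + ‖s‖ ^ ((d : ℝ) + c))

/-- The Fourier transforms are jointly continuous and strictly positive on `Θ × ℝ^d`.
Positivity forces every `k_θ`, `θ ∈ Θ`, to be integrable, as the integral would be `0` otherwise. -/
structure FourierPositive {d p : ℕ} (Θ : Set (Param p)) (k : Param p → Space d → ℝ) : Prop where
  continuousOn : ContinuousOn (fun q : Param p × Space d => fourierTransform (k q.1) q.2)
    (Θ ×ˢ Set.univ)
  pos : ∀ θ ∈ Θ, ∀ f : Space d,
    0 < (fourierTransform (k θ) f).re ∧ (fourierTransform (k θ) f).im = 0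

/-- Global identifiability at `θ₀`. The infimum is taken in the extended reals, so that it is `+∞`
over the empty set. -/
def GloballyIdentifiable {d p : ℕ} (Θ : Set (Param p)) (k : Param p → Space d → ℝ)
    (s : ℕ → Space d) (θ₀ : Param p) : Prop :=
  ∀ α : ℝ, 0 < α →
    (0 : EReal) < liminf (fun n : ℕ => ⨅ θ ∈ Θ, ⨅ _ : α ≤ ‖θ - θ₀‖,
      (((1 / (n : ℝ)) * ∑ i : Fin n, ∑ j : Fin n,
        (k θ (s i - s j) - k θ₀ (s i - s j)) ^ 2 : ℝ) : EReal)) atTop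

/-- The criterion `L_θ = (1/n) (log det R_θ + yᵀ R_θ⁻¹ y)` for an observation vector `y`. -/
noncomputable def gaussianCriterion {d p : ℕ} (k : Param p → Space d → ℝ) (s : ℕ → Space d)
    (n : ℕ) (y : Fin n → ℝ) (θ : Param p) : ℝ :=
  (1 / (n : ℝ)) * (Real.log (covMatrix (k θ) s n).det +
    y ⬝ᵥ Matrix.mulVec (covMatrix (k θ) s n)⁻¹ y)

/-- The observation vector `y = (Y(s_1), …, Y(s_n))`. -/
def observation {d : ℕ} {Ω : Type*} (Y : Space d → Ω → ℝ) (s : ℕ → Space d) (n : ℕ) (ω : Ω) :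
    Fin n → ℝ :=
  fun i => Y (s i) ω

/-- `θhat n` is, for every sample size `n ≥ 1`, almost surely a minimizer over `Θ` of the Gaussian
criterion evaluated at the observation vector of `Y`. -/
def IsGaussianMLE {d p : ℕ} {Ω : Type*} [MeasurableSpace Ω] (P : Measure Ω) (Θ : Set (Param p))
    (k : Param p → Space d → ℝ) (Y : Space d → Ω → ℝ) (s : ℕ → Space d)
    (θhat : ℕ → Ω → Param p) : Prop :=
  ∀ n : ℕ, 1 ≤ n → ∀ᵐ ω ∂P, θhat n ω ∈ Θ ∧
    IsMinOn (gaussianCriterion k s n (observation Y s n ω)) Θ (θhat n ω)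

/-!
For a covariance matrix `R` of the model and the true one `R₀`, the difference of the criteria at `θ`
and `θ₀` splits (`gaussianCriterion_sub`) into the deterministic contrast
`(1 / n) (log det R - log det R₀ + tr (R⁻¹ R₀) - n)` and two centred fluctuations of the form
`(1 / n) (yᵀ A y - E yᵀ A y)`, with `A = R⁻¹` and `A = R₀⁻¹`. A minimizer away from `θ₀` is excluded
once the contrast is bounded below there and the fluctuations are uniformly small.

*Conditioning.* The matrices `R` have eigenvalues in a fixed compact subset of `(0, ∞)`. The upper
bound is the Schur test. For the lower bound (`FourierPositive.exists_quadForm_ge`), the function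
`q t = ∑ v i v j k (s i - s j + t)` satisfies `q t ≤ q 0` by positive definiteness. Hence `q 0`
dominates a Gaussian average of `q`, which Fubini's theorem expresses by the Fourier transform of `k`.
That transform is bounded below on compact sets of frequencies, and narrow Gaussian kernels over
well-separated points are nearly diagonal. Neither continuity of `k` nor Fourier inversion enters.

*Contrast.* Diagonalizing `R` and `R₀` simultaneously by a congruence turns the contrast into a sum of
terms `x - 1 - log x`, which dominates the squared Frobenius distance of `R` and `R₀`
(`exists_kullback_ge`). Global identifiability then bounds it below.

*Fluctuations.* If `Z k` and `Z l` are replaced by their residuals after linear regression on `Z i` and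
`Z j`, they become independent of the latter, and the products `T (Z k) T (Z l)` change by an amount
linear in the covariances. So the covariance of `Y i Y j` and `Y k Y l` is at most a constant times the
sum of the four cross covariances of `Z` (`GaussianSequence.exists_abs_covariance_mul_le`), which are
summable. This makes the variance of `yᵀ A y` at most of order `n` when the absolute row sums of the
symmetric matrix `A` are bounded (`GaussianSequence.exists_variance_le`). Inverses `R⁻¹` are
approximated in operator norm by such matrices, namely truncated Neumann series
(`exists_approx_inverse`), and a finite cover of the parameter set gives uniformity
(`QuadraticLLN.tendsto_measure_exists_inv`).
-/

/-! ### Sums over well-separated sequences -/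

/-- Disjoint balls of a common radius around the points compare the sum with an integral. -/
theorem WellSeparated.exists_sum_rpow_le {d : ℕ} {s : ℕ → Space d} (hs : WellSeparated s) {r : ℝ}
    (hr : (d : ℝ) < r) :
    ∃ K : ℝ, 0 < K ∧ ∀ (x : Space d) (A : Finset ℕ), ∑ j ∈ A, (1 + ‖x - s j‖) ^ (-r) ≤ K := by
  obtain ⟨δ, hδ, hsep⟩ := hs
  have hr0 : 0 < r := lt_of_le_of_lt (Nat.cast_nonneg d) hr
  have hint : Integrable (fun x : Space d => (1 + ‖x‖) ^ (-r)) :=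
    integrable_one_add_norm (by simpa using hr)
  have hnn : ∀ x : Space d, 0 ≤ (1 + ‖x‖) ^ (-r) := fun x => by positivity
  set I := ∫ x : Space d, (1 + ‖x‖) ^ (-r) with hI
  have hI0 : 0 ≤ I := integral_nonneg hnn
  refine ⟨(1 + δ / 2) ^ r * I / δ ^ d + 1, by positivity, fun x A => ?_⟩
  have hintx : Integrable (fun y : Space d => (1 + ‖x - y‖) ^ (-r)) := hint.comp_sub_left x
  have hball : ∀ j, volume.real (Metric.ball (s j) (δ / 2)) = δ ^ d := by
    intro j
    rw [Measure.real, Real.volume_pi_ball _ (by positivity), ENNReal.toReal_ofReal (by positivity)]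
    simp [mul_div_cancel₀]
  have hterm : ∀ j, δ ^ d * (1 + ‖x - s j‖) ^ (-r) ≤
      (1 + δ / 2) ^ r * ∫ y in Metric.ball (s j) (δ / 2), (1 + ‖x - y‖) ^ (-r) := by
    intro j
    rw [← integral_const_mul]
    have h1 : ∫ y in Metric.ball (s j) (δ / 2), (1 + ‖x - s j‖) ^ (-r) =
        δ ^ d * (1 + ‖x - s j‖) ^ (-r) := by
      rw [setIntegral_const, hball, smul_eq_mul]
    rw [← h1]
    refine setIntegral_mono_on ?_ ((hintx.const_mul _).integrableOn) measurableSet_ball ?_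
    · exact integrableOn_const (measure_ball_lt_top.ne)
    · intro y hy
      have hy' : ‖y - s j‖ < δ / 2 := by simpa [dist_eq_norm] using hy
      have h2 : 1 + ‖x - y‖ ≤ (1 + δ / 2) * (1 + ‖x - s j‖) := by
        have : ‖x - y‖ ≤ ‖x - s j‖ + ‖y - s j‖ := by
          have := norm_sub_le (x - s j) (y - s j)
          simpa using this
        nlinarith [norm_nonneg (x - s j), hδ]
      have h3 : ((1 + δ / 2) * (1 + ‖x - s j‖)) ^ (-r) ≤ (1 + ‖x - y‖) ^ (-r) :=
        Real.rpow_le_rpow_of_nonpos (by positivity) h2 (by linarith)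
      rw [Real.mul_rpow (by positivity) (by positivity)] at h3
      calc (1 + ‖x - s j‖) ^ (-r)
          = (1 + δ / 2) ^ r * ((1 + δ / 2) ^ (-r) * (1 + ‖x - s j‖) ^ (-r)) := by
            rw [← mul_assoc, ← Real.rpow_add (by positivity)]; simp
        _ ≤ _ := by gcongr
  have hdisj : Set.Pairwise (A : Set ℕ) (Function.onFun Disjoint fun j => Metric.ball (s j) (δ / 2)) := by
    intro i _ j _ hij
    refine Metric.ball_disjoint_ball ?_
    rw [dist_eq_norm]
    linarith [hsep i j hij]
  have hsum : ∑ j ∈ A, ∫ y in Metric.ball (s j) (δ / 2), (1 + ‖x - y‖) ^ (-r) ≤ I := by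
    rw [← integral_biUnion_finset A (fun j _ => measurableSet_ball) hdisj
      (fun j _ => hintx.integrableOn)]
    calc _ ≤ ∫ y : Space d, (1 + ‖x - y‖) ^ (-r) :=
          setIntegral_le_integral hintx (Eventually.of_forall fun y => by positivity)
      _ = I := integral_sub_left_eq_self (fun y : Space d => (1 + ‖y‖) ^ (-r)) volume x
  have h4 : δ ^ d * ∑ j ∈ A, (1 + ‖x - s j‖) ^ (-r) ≤ (1 + δ / 2) ^ r * I := by
    rw [Finset.mul_sum]
    calc _ ≤ ∑ j ∈ A, (1 + δ / 2) ^ r * ∫ y in Metric.ball (s j) (δ / 2), (1 + ‖x - y‖) ^ (-r) :=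
          Finset.sum_le_sum fun j _ => hterm j
      _ ≤ _ := by rw [← Finset.mul_sum]; gcongr
  have h5 : ∑ j ∈ A, (1 + ‖x - s j‖) ^ (-r) ≤ (1 + δ / 2) ^ r * I / δ ^ d := by
    rw [le_div_iff₀ (by positivity)]; linarith
  linarith

theorem exists_exp_neg_le_rpow {c : ℝ} (hc : 0 < c) (r : ℝ) :
    ∃ K : ℝ, 0 < K ∧ ∀ t : ℝ, 0 ≤ t → Real.exp (-c * t) ≤ K * (1 + t) ^ (-r) := by
  have h := (isLittleO_exp_neg_mul_rpow_atTop hc (-r)).bound (c := 1) one_pos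
  obtain ⟨M, hM⟩ := eventually_atTop.1 h
  have hcont : ContinuousOn (fun t : ℝ => Real.exp (-c * t) * (1 + t) ^ r) (Set.Icc 0 (max M 0)) := by
    refine ContinuousOn.mul (by fun_prop) ?_
    refine ContinuousOn.rpow_const (by fun_prop) fun t ht => Or.inl ?_
    linarith [ht.1]
  obtain ⟨B, hB⟩ := isCompact_Icc.bddAbove_image hcont
  refine ⟨max B (Real.exp c), lt_max_of_lt_right (Real.exp_pos _), fun t ht => ?_⟩
  have hpos : 0 < (1 + t) ^ r := by positivity
  rw [Real.rpow_neg (by positivity), ← div_eq_mul_inv, le_div_iff₀ hpos]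
  by_cases htM : t ≤ max M 0
  · exact le_max_of_le_left (hB (Set.mem_image_of_mem _ ⟨ht, htM⟩))
  · refine le_max_of_le_right ?_
    push Not at htM
    have h1 := hM (1 + t) (by linarith [le_max_left M 0])
    rw [Real.norm_of_nonneg (by positivity), Real.norm_of_nonneg (by positivity), one_mul,
      Real.rpow_neg (by positivity)] at h1
    have h2 : Real.exp (-c * (1 + t)) * (1 + t) ^ r ≤ 1 := by
      calc _ ≤ ((1 + t) ^ r)⁻¹ * (1 + t) ^ r := by gcongr
        _ = 1 := inv_mul_cancel₀ hpos.ne'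
    have h3 : Real.exp (-c * t) = Real.exp c * Real.exp (-c * (1 + t)) := by
      rw [← Real.exp_add]; ring_nf
    rw [h3, mul_assoc]
    calc _ ≤ Real.exp c * 1 := by gcongr
      _ = _ := mul_one _

theorem WellSeparated.exists_sum_exp_le {d : ℕ} {s : ℕ → Space d} (hs : WellSeparated s) {c : ℝ}
    (hc : 0 < c) :
    ∃ K : ℝ, 0 < K ∧ ∀ (x : Space d) (A : Finset ℕ), ∑ j ∈ A, Real.exp (-c * ‖x - s j‖) ≤ K := by
  obtain ⟨K, hK, h⟩ := hs.exists_sum_rpow_le (r := d + 1) (by linarith)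
  obtain ⟨K', hK', h'⟩ := exists_exp_neg_le_rpow hc (d + 1)
  refine ⟨K' * K, by positivity, fun x A => ?_⟩
  calc _ ≤ ∑ j ∈ A, K' * (1 + ‖x - s j‖) ^ (-((d : ℝ) + 1)) :=
        Finset.sum_le_sum fun j _ => h' _ (norm_nonneg _)
    _ ≤ _ := by rw [← Finset.mul_sum]; gcongr; exact h x A

theorem one_div_one_add_rpow_le {a t : ℝ} (ha : 0 ≤ a) (ht : 0 ≤ t) :
    1 / (1 + t ^ a) ≤ 2 ^ a * (1 + t) ^ (-a) := by
  rw [Real.rpow_neg (by positivity), ← div_eq_mul_inv, div_le_div_iff₀ (by positivity) (by positivity),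
    one_mul]
  rcases le_total t 1 with h | h
  · calc (1 + t) ^ a ≤ 2 ^ a * 1 := by rw [mul_one]; gcongr; linarith
      _ ≤ _ := by gcongr; linarith [Real.rpow_nonneg ht a]
  · calc (1 + t) ^ a ≤ (2 * t) ^ a := by gcongr; linarith
      _ = 2 ^ a * t ^ a := Real.mul_rpow (by norm_num) ht
      _ ≤ _ := by gcongr; linarith

theorem WellSeparated.exists_sum_one_div_le {d : ℕ} {s : ℕ → Space d} (hs : WellSeparated s) {c : ℝ}
    (hc : 0 < c) :
    ∃ K : ℝ, 0 < K ∧ ∀ (x : Space d) (A : Finset ℕ),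
      ∑ j ∈ A, 1 / (1 + ‖x - s j‖ ^ ((d : ℝ) + c)) ≤ K := by
  obtain ⟨K, hK, h⟩ := hs.exists_sum_rpow_le (r := d + c) (by linarith)
  refine ⟨2 ^ ((d : ℝ) + c) * K, by positivity, fun x A => ?_⟩
  calc _ ≤ ∑ j ∈ A, 2 ^ ((d : ℝ) + c) * (1 + ‖x - s j‖) ^ (-((d : ℝ) + c)) :=
        Finset.sum_le_sum fun j _ => one_div_one_add_rpow_le (by positivity) (norm_nonneg _)
    _ ≤ _ := by rw [← Finset.mul_sum]; gcongr; exact h x A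

/-- Over a well-separated sequence, narrow Gaussian kernels are nearly diagonal. -/
theorem WellSeparated.exists_sum_gaussian_le {d : ℕ} {s : ℕ → Space d} (hs : WellSeparated s) :
    ∃ b₀ : ℝ, 0 < b₀ ∧ ∀ b, 0 < b → b ≤ b₀ → ∀ (i : ℕ) (A : Finset ℕ), i ∉ A →
      ∑ j ∈ A, Real.exp (-((s i - s j) ⬝ᵥ (s i - s j)) / (4 * b)) ≤ 1 / 2 := by
  obtain ⟨K, hK, h⟩ := hs.exists_sum_exp_le one_pos
  obtain ⟨δ, hδ, hsep⟩ := hs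
  -- For `‖x‖ ≥ δ` one has `x ⬝ᵥ x / (4 b) ≥ ‖x‖ + δ ^ 2 / (8 b)` once `b ≤ δ / 8`, and the second
  -- summand is at least `2 K` once `b ≤ δ ^ 2 / (16 K)`; finally `exp (-2 K) * K ≤ 1 / 2`.
  refine ⟨min (δ / 8) (δ ^ 2 / (16 * K)), by positivity, fun b hb hb0 i A hi => ?_⟩
  have hb1 : b ≤ δ / 8 := hb0.trans (min_le_left _ _)
  have hb2 : b * (16 * K) ≤ δ ^ 2 := by
    rw [← le_div_iff₀ (by positivity)]; exact hb0.trans (min_le_right _ _)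
  have hterm : ∀ j ∈ A, Real.exp (-((s i - s j) ⬝ᵥ (s i - s j)) / (4 * b)) ≤
      Real.exp (-(2 * K)) * Real.exp (-1 * ‖s i - s j‖) := by
    intro j hj
    have hij : i ≠ j := fun e => hi (e ▸ hj)
    have hd := hsep i j hij
    set x := s i - s j with hx
    have hsq : ‖x‖ ^ 2 ≤ x ⬝ᵥ x := by
      have hnn : 0 ≤ x ⬝ᵥ x := by
        simp only [dotProduct]; exact Finset.sum_nonneg fun k _ => mul_self_nonneg _
      have : ‖x‖ ≤ Real.sqrt (x ⬝ᵥ x) := by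
        rw [pi_norm_le_iff_of_nonneg (Real.sqrt_nonneg _)]
        intro k
        refine Real.le_sqrt_of_sq_le ?_
        rw [Real.norm_eq_abs, sq_abs, sq]
        exact Finset.single_le_sum (f := fun k => x k * x k) (fun k _ => mul_self_nonneg _)
          (Finset.mem_univ k)
      calc ‖x‖ ^ 2 ≤ Real.sqrt (x ⬝ᵥ x) ^ 2 := by gcongr
        _ = _ := Real.sq_sqrt hnn
    rw [← Real.exp_add, Real.exp_le_exp, div_le_iff₀ (by positivity)]
    have h1 : δ * ‖x‖ ≤ ‖x‖ ^ 2 := by nlinarith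
    have h2 : δ ^ 2 ≤ ‖x‖ ^ 2 := by gcongr
    nlinarith [norm_nonneg x]
  have hexp : Real.exp (-(2 * K)) * K ≤ 1 / 2 := by
    rw [Real.exp_neg, inv_mul_le_iff₀ (Real.exp_pos _)]
    nlinarith [Real.add_one_le_exp (2 * K)]
  calc _ ≤ ∑ j ∈ A, Real.exp (-(2 * K)) * Real.exp (-1 * ‖s i - s j‖) := Finset.sum_le_sum hterm
    _ ≤ Real.exp (-(2 * K)) * K := by rw [← Finset.mul_sum]; gcongr; exact h _ A
    _ ≤ _ := hexp

/-! ### Coercivity of covariance matrices with positive Fourier transform -/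

theorem covMatrix_quadForm {d : ℕ} (k : Space d → ℝ) (s : ℕ → Space d) (n : ℕ) (v : Fin n → ℝ) :
    v ⬝ᵥ (covMatrix k s n).mulVec v = ∑ i, ∑ j, v i * v j * k (s i - s j) := by
  simp only [dotProduct, Matrix.mulVec, covMatrix, Matrix.of_apply, Finset.mul_sum]
  exact Finset.sum_congr rfl fun i _ => Finset.sum_congr rfl fun j _ => by ring

theorem IsStationaryCovariance.even {d : ℕ} {k : Space d → ℝ} (hk : IsStationaryCovariance k)
    (x : Space d) : k (-x) = k x := by
  have h := (hk 2 (fun m => if m = 0 then x else 0)).isHermitian.apply 0 1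
  simpa [covMatrix] using h

/-- A linear combination of translates `∑ v i v j k (s i - s j + t)` of a covariance function
is again positive definite in `t`, hence maximal at `t = 0`. -/
theorem IsStationaryCovariance.quadForm_add_le {d : ℕ} {k : Space d → ℝ}
    (hk : IsStationaryCovariance k) (s : ℕ → Space d) (n : ℕ) (v : Fin n → ℝ) (t : Space d) :
    ∑ i, ∑ j, v i * v j * k (s i - s j + t) ≤ ∑ i, ∑ j, v i * v j * k (s i - s j) := by
  have h := (hk (n + n) (fun m => if m < n then s m else s (m - n) - t)).dotProduct_mulVec_nonneg
    (Fin.append v (-v))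
  rw [star_trivial, covMatrix_quadForm] at h
  simp only [Fin.sum_univ_add, Fin.append_left, Fin.append_right, Fin.val_castAdd, Fin.val_natAdd,
    Fin.is_lt, if_true, Pi.neg_apply, Nat.add_sub_cancel_left, not_lt.2 (Nat.le_add_right n _),
    if_false, Finset.sum_add_distrib] at h
  have e1 : ∀ i j : Fin n, s i - (s j - t) = s i - s j + t := fun i j => by abel
  have e2 : ∀ i j : Fin n, k (s i - t - s j) = k (s j - s i + t) := fun i j => by
    rw [← hk.even]; congr 1; abel
  have e3 : ∀ i j : Fin n, s i - t - (s j - t) = s i - s j := fun i j => by abel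
  simp only [e1, e2, e3, neg_mul, mul_neg, neg_neg, Finset.sum_neg_distrib] at h
  rw [Finset.sum_comm (f := fun i j => v i * v j * k (s j - s i + t))] at h
  simp only [mul_comm (v _) (v _)] at h ⊢
  have e4 : ∑ y : Fin n, ∑ x : Fin n, v x * v y * k (s y - s x + t) =
    ∑ y : Fin n, ∑ x : Fin n, v y * v x * k (s y - s x + t) :=
      Finset.sum_congr rfl fun i _ => Finset.sum_congr rfl fun j _ => by ring
  have e5 : ∑ y : Fin n, ∑ x : Fin n, v x * v y * k (s y - s x) =
    ∑ y : Fin n, ∑ x : Fin n, v y * v x * k (s y - s x) :=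
      Finset.sum_congr rfl fun i _ => Finset.sum_congr rfl fun j _ => by ring
  linarith

theorem integrable_gaussian {d : ℕ} {b : ℝ} (hb : 0 < b) :
    Integrable (fun f : Space d => Real.exp (-b * (f ⬝ᵥ f))) := by
  have h := (GaussianFourier.integrable_cexp_neg_mul_sum_add (ι := Fin d) (b := (b : ℂ))
    (by simpa using hb) 0).re
  refine h.congr (Eventually.of_forall fun f => ?_)
  have : (-(b : ℂ) * ∑ i, (f i : ℂ) ^ 2 + ∑ i, (0 : Fin d → ℂ) i * (f i : ℂ)) =
      ((-b * (f ⬝ᵥ f) : ℝ) : ℂ) := by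
    simp [dotProduct, sq]
  simp only [this, ← Complex.ofReal_exp]
  exact Complex.ofReal_re _

/-- The Fourier transform of a Gaussian, in real form. -/
theorem integral_gaussian_mul_cos {d : ℕ} {b : ℝ} (hb : 0 < b) (x : Space d) :
    ∫ f : Space d, Real.exp (-b * (f ⬝ᵥ f)) * Real.cos (f ⬝ᵥ x) =
      (Real.pi / b) ^ ((d : ℝ) / 2) * Real.exp (-(x ⬝ᵥ x) / (4 * b)) := by
  have hb' : 0 < (b : ℂ).re := by simpa using hb
  have h := GaussianFourier.integral_cexp_neg_mul_sum_add (ι := Fin d) hb' (fun i => Complex.I * x i)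
  have hi := GaussianFourier.integrable_cexp_neg_mul_sum_add (ι := Fin d) hb' (fun i => Complex.I * x i)
  have h2 := congrArg Complex.re h
  have e1 : ∀ f : Space d, (Complex.exp (-(b : ℂ) * ∑ i, (f i : ℂ) ^ 2 +
      ∑ i, (Complex.I * x i) * (f i : ℂ))).re = Real.exp (-b * (f ⬝ᵥ f)) * Real.cos (f ⬝ᵥ x) := by
    intro f
    have : (-(b : ℂ) * ∑ i, (f i : ℂ) ^ 2 + ∑ i, (Complex.I * x i) * (f i : ℂ)) =
      ((-b * (f ⬝ᵥ f) : ℝ) : ℂ) + ((f ⬝ᵥ x : ℝ) : ℂ) * Complex.I := by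
      simp only [dotProduct, sq]
      push_cast
      rw [Finset.sum_mul]
      congr 1
      exact Finset.sum_congr rfl fun i _ => by ring
    rw [this, Complex.exp_re]
    simp [-Complex.ofReal_mul, -Complex.ofReal_neg]
  have e2 : (∑ i, (Complex.I * (x i : ℂ)) ^ 2) / (4 * (b : ℂ)) =
      ((-(x ⬝ᵥ x) / (4 * b) : ℝ) : ℂ) := by
    simp only [dotProduct]
    push_cast
    congr 1
    rw [← Finset.sum_neg_distrib]
    exact Finset.sum_congr rfl fun i _ => by rw [mul_pow, Complex.I_sq]; ring
  have e3 : ((Real.pi : ℂ) / b) ^ ((Fintype.card (Fin d) : ℂ) / 2) =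
      (((Real.pi / b) ^ ((d : ℝ) / 2) : ℝ) : ℂ) := by
    rw [Complex.ofReal_cpow (by positivity)]
    simp
  rw [e2, e3, ← Complex.ofReal_exp, ← Complex.ofReal_mul, Complex.ofReal_re] at h2
  rw [← h2]
  have h3 := integral_re hi
  simp only [RCLike.re_to_complex] at h3
  rw [← h3]
  exact integral_congr_ae (Eventually.of_forall fun f => (e1 f).symm)

theorem integrable_mul_cos {d : ℕ} {k : Space d → ℝ} (hk : Integrable k) (f : Space d) :
    Integrable (fun u => k u * Real.cos (f ⬝ᵥ u)) := by
  refine hk.mul_bdd (c := 1) ?_ (Eventually.of_forall fun u => Real.abs_cos_le_one _)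
  exact (by simp only [dotProduct]; fun_prop : Continuous fun u => Real.cos (f ⬝ᵥ u)).aestronglyMeasurable

theorem integrable_mul_sin {d : ℕ} {k : Space d → ℝ} (hk : Integrable k) (f : Space d) :
    Integrable (fun u => k u * Real.sin (f ⬝ᵥ u)) := by
  refine hk.mul_bdd (c := 1) ?_ (Eventually.of_forall fun u => Real.abs_sin_le_one _)
  exact (by simp only [dotProduct]; fun_prop : Continuous fun u => Real.sin (f ⬝ᵥ u)).aestronglyMeasurable

theorem fourierTransform_eq {d : ℕ} {k : Space d → ℝ} (hk : Integrable k) (f : Space d) :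
    (fourierTransform k f).re = ((2 * Real.pi) ^ d)⁻¹ * ∫ u, k u * Real.cos (f ⬝ᵥ u) ∧
    (fourierTransform k f).im = -(((2 * Real.pi) ^ d)⁻¹ * ∫ u, k u * Real.sin (f ⬝ᵥ u)) := by
  have e : ∀ t : Space d, (k t : ℂ) * Complex.exp (-Complex.I * ((f ⬝ᵥ t : ℝ) : ℂ)) =
      ((k t * Real.cos (f ⬝ᵥ t) : ℝ) : ℂ) - ((k t * Real.sin (f ⬝ᵥ t) : ℝ) : ℂ) * Complex.I := by
    intro t
    have : -Complex.I * ((f ⬝ᵥ t : ℝ) : ℂ) = ((-(f ⬝ᵥ t) : ℝ) : ℂ) * Complex.I := by push_cast; ring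
    rw [this, Complex.exp_mul_I, ← Complex.ofReal_cos, ← Complex.ofReal_sin, Real.cos_neg, Real.sin_neg]
    push_cast; ring
  have h : ∫ t : Space d, (k t : ℂ) * Complex.exp (-Complex.I * ((f ⬝ᵥ t : ℝ) : ℂ)) =
      ((∫ u, k u * Real.cos (f ⬝ᵥ u) : ℝ) : ℂ) - ((∫ u, k u * Real.sin (f ⬝ᵥ u) : ℝ) : ℂ) * Complex.I := by
    simp_rw [e]
    rw [integral_sub (integrable_mul_cos hk f).ofReal ((integrable_mul_sin hk f).ofReal.mul_const _),
      integral_mul_const, integral_complex_ofReal, integral_complex_ofReal]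
  rw [fourierTransform, h]
  constructor
  · rw [Complex.re_ofReal_mul]; simp
  · rw [Complex.im_ofReal_mul]; simp

/-- A function whose Fourier transform does not vanish is integrable, since the integral would
take the value `0` otherwise. -/
theorem integrable_of_fourierTransform_pos {d : ℕ} {k : Space d → ℝ}
    (h : 0 < (fourierTransform k 0).re) : Integrable k := by
  by_contra hk
  have : ¬ Integrable (fun t : Space d =>
      (k t : ℂ) * Complex.exp (-Complex.I * (((0 : Space d) ⬝ᵥ t : ℝ) : ℂ))) := by
    simpa using fun h' : Integrable (fun t => (k t : ℂ)) => hk h'.re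
  rw [fourierTransform, integral_undef this] at h
  simp at h

/-- Gaussian smoothing of an even integrable function, computed on the Fourier side. -/
theorem integral_add_mul_gaussian {d : ℕ} {k : Space d → ℝ} (hk : Integrable k)
    (hsin : ∀ f : Space d, ∫ u, k u * Real.sin (f ⬝ᵥ u) = 0) {b : ℝ} (hb : 0 < b) (x : Space d) :
    (Real.pi / b) ^ ((d : ℝ) / 2) * ∫ t, k (x + t) * Real.exp (-(t ⬝ᵥ t) / (4 * b)) =
      ∫ f, Real.exp (-b * (f ⬝ᵥ f)) * (Real.cos (f ⬝ᵥ x) * ∫ u, k u * Real.cos (f ⬝ᵥ u)) := by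
  have h1 : ∫ t, k (x + t) * Real.exp (-(t ⬝ᵥ t) / (4 * b)) =
      ∫ u, k u * Real.exp (-((u - x) ⬝ᵥ (u - x)) / (4 * b)) := by
    rw [← integral_add_left_eq_self (fun u => k u * Real.exp (-((u - x) ⬝ᵥ (u - x)) / (4 * b))) x]
    simp
  have h2 : ∀ u, (Real.pi / b) ^ ((d : ℝ) / 2) * (k u * Real.exp (-((u - x) ⬝ᵥ (u - x)) / (4 * b))) =
      ∫ f, k u * (Real.exp (-b * (f ⬝ᵥ f)) * Real.cos (f ⬝ᵥ (u - x))) := by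
    intro u
    rw [integral_const_mul, integral_gaussian_mul_cos hb]; ring
  rw [h1, ← integral_const_mul]
  simp_rw [h2]
  rw [integral_integral_swap]
  · refine integral_congr_ae (Eventually.of_forall fun f => ?_)
    have e : ∀ u, k u * (Real.exp (-b * (f ⬝ᵥ f)) * Real.cos (f ⬝ᵥ (u - x))) =
        Real.exp (-b * (f ⬝ᵥ f)) * (Real.cos (f ⬝ᵥ x) * (k u * Real.cos (f ⬝ᵥ u)) +
          Real.sin (f ⬝ᵥ x) * (k u * Real.sin (f ⬝ᵥ u))) := by
      intro u
      rw [dotProduct_sub, Real.cos_sub]; ring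
    simp only [e]
    rw [integral_const_mul, integral_add ((integrable_mul_cos hk f).const_mul _)
      ((integrable_mul_sin hk f).const_mul _), integral_const_mul, integral_const_mul, hsin]
    ring
  · have h3 := (hk.mul_prod (integrable_gaussian (d := d) hb)).mul_bdd (c := 1)
      (f := fun z : Space d × Space d => k z.1 * Real.exp (-b * (z.2 ⬝ᵥ z.2)))
      (g := fun z : Space d × Space d => Real.cos (z.2 ⬝ᵥ (z.1 - x)))
      (by
        refine Continuous.aestronglyMeasurable ?_
        simp only [dotProduct]; fun_prop) (Eventually.of_forall fun u => Real.abs_cos_le_one _)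
    refine h3.congr (Eventually.of_forall fun z => ?_)
    simp only [Function.uncurry]; ring

theorem sum_mul_cos_sub_nonneg {ι : Type*} [Fintype ι] (v a : ι → ℝ) :
    0 ≤ ∑ i, ∑ j, v i * v j * Real.cos (a i - a j) := by
  have : ∑ i, ∑ j, v i * v j * Real.cos (a i - a j) =
      (∑ i, v i * Real.cos (a i)) ^ 2 + (∑ i, v i * Real.sin (a i)) ^ 2 := by
    rw [sq, sq, Finset.sum_mul_sum, Finset.sum_mul_sum, ← Finset.sum_add_distrib]
    refine Finset.sum_congr rfl fun i _ => ?_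
    rw [← Finset.sum_add_distrib]
    refine Finset.sum_congr rfl fun j _ => ?_
    rw [Real.cos_sub]; ring
  rw [this]; positivity

/-- The spectral weight `|∑ j, v j exp (i f ⬝ᵥ s j)| ^ 2`, in real form. -/
noncomputable def spectralWeight {d : ℕ} (s : ℕ → Space d) (n : ℕ) (v : Fin n → ℝ) (f : Space d) : ℝ :=
  ∑ i, ∑ j, v i * v j * Real.cos (f ⬝ᵥ (s i - s j))

theorem spectralWeight_nonneg {d : ℕ} (s : ℕ → Space d) (n : ℕ) (v : Fin n → ℝ) (f : Space d) :
    0 ≤ spectralWeight s n v f := by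
  have h := sum_mul_cos_sub_nonneg v (fun i => f ⬝ᵥ s i)
  simpa only [spectralWeight, dotProduct_sub] using h

theorem integrable_gaussian_mul_cos {d : ℕ} {b : ℝ} (hb : 0 < b) (x : Space d) :
    Integrable (fun f : Space d => Real.exp (-b * (f ⬝ᵥ f)) * Real.cos (f ⬝ᵥ x)) := by
  refine (integrable_gaussian hb).mul_bdd (c := 1) ?_ (Eventually.of_forall fun u => Real.abs_cos_le_one _)
  exact (by simp only [dotProduct]; fun_prop :
    Continuous fun u : Space d => Real.cos (u ⬝ᵥ x)).aestronglyMeasurable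

theorem integrable_gaussian_mul_spectralWeight {d : ℕ} {b : ℝ} (hb : 0 < b) (s : ℕ → Space d) (n : ℕ)
    (v : Fin n → ℝ) :
    Integrable (fun f : Space d => Real.exp (-b * (f ⬝ᵥ f)) * spectralWeight s n v f) := by
  simp only [spectralWeight, Finset.mul_sum]
  refine integrable_finsetSum _ fun i _ => integrable_finsetSum _ fun j _ => ?_
  refine ((integrable_gaussian_mul_cos hb (s i - s j)).const_mul (v i * v j)).congr
    (Eventually.of_forall fun f => ?_)
  simp only; ring

theorem integral_gaussian_mul_spectralWeight {d : ℕ} {b : ℝ} (hb : 0 < b) (s : ℕ → Space d) (n : ℕ)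
    (v : Fin n → ℝ) :
    ∫ f : Space d, Real.exp (-b * (f ⬝ᵥ f)) * spectralWeight s n v f =
      (Real.pi / b) ^ ((d : ℝ) / 2) *
        ∑ i, ∑ j, v i * v j * Real.exp (-((s i - s j) ⬝ᵥ (s i - s j)) / (4 * b)) := by
  have e : ∀ f : Space d, Real.exp (-b * (f ⬝ᵥ f)) * spectralWeight s n v f =
      ∑ i, ∑ j, v i * v j * (Real.exp (-b * (f ⬝ᵥ f)) * Real.cos (f ⬝ᵥ (s i - s j))) := by
    intro f
    simp only [spectralWeight, Finset.mul_sum]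
    exact Finset.sum_congr rfl fun i _ => Finset.sum_congr rfl fun j _ => by ring
  simp_rw [e]
  rw [integral_finsetSum _ fun i _ => integrable_finsetSum _ fun j _ =>
    (integrable_gaussian_mul_cos hb (s (i : Fin n) - s (j : Fin n))).const_mul (v i * v j),
    Finset.mul_sum]
  refine Finset.sum_congr rfl fun i _ => ?_
  rw [integral_finsetSum _ fun j _ =>
    (integrable_gaussian_mul_cos hb (s i - s (j : Fin n))).const_mul (v i * v j), Finset.mul_sum]
  refine Finset.sum_congr rfl fun j _ => ?_
  rw [integral_const_mul, integral_gaussian_mul_cos hb]; ring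

theorem continuous_integral_mul_cos {d : ℕ} {k : Space d → ℝ} (hk : Integrable k) :
    Continuous (fun f : Space d => ∫ u, k u * Real.cos (f ⬝ᵥ u)) := by
  refine continuous_of_dominated (bound := fun u => |k u|)
    (fun f => (integrable_mul_cos hk f).aestronglyMeasurable) ?_ hk.abs ?_
  · refine fun f => Eventually.of_forall fun u => ?_
    rw [Real.norm_eq_abs, abs_mul]
    exact mul_le_of_le_one_right (abs_nonneg _) (Real.abs_cos_le_one _)
  · refine Eventually.of_forall fun u => ?_
    simp only [dotProduct]; fun_prop

theorem norm_integral_mul_cos_le {d : ℕ} {k : Space d → ℝ} (hk : Integrable k) (f : Space d) :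
    ‖∫ u, k u * Real.cos (f ⬝ᵥ u)‖ ≤ ∫ u, |k u| := by
  refine norm_integral_le_of_norm_le hk.abs (Eventually.of_forall fun u => ?_)
  rw [Real.norm_eq_abs, abs_mul]
  exact mul_le_of_le_one_right (abs_nonneg _) (Real.abs_cos_le_one _)

theorem integrable_spectral {d : ℕ} {k : Space d → ℝ} (hk : Integrable k) {b : ℝ} (hb : 0 < b)
    (x : Space d) :
    Integrable (fun f : Space d =>
      Real.exp (-b * (f ⬝ᵥ f)) * (Real.cos (f ⬝ᵥ x) * ∫ u, k u * Real.cos (f ⬝ᵥ u))) := by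
  have h := (integrable_gaussian_mul_cos hb x).mul_bdd (c := ∫ u, |k u|)
    (continuous_integral_mul_cos hk).aestronglyMeasurable
    (Eventually.of_forall fun f => norm_integral_mul_cos_le hk f)
  refine h.congr (Eventually.of_forall fun f => ?_)
  simp only; ring

/-- The quadratic form of a covariance function dominates the spectral weight integrated against
its Fourier transform, damped by a Gaussian factor. No continuity of `k` is needed. -/
theorem IsStationaryCovariance.integral_spectral_le {d : ℕ} {k : Space d → ℝ}
    (hk : IsStationaryCovariance k) (hki : Integrable k)
    (hsin : ∀ f : Space d, ∫ u, k u * Real.sin (f ⬝ᵥ u) = 0) {b : ℝ} (hb : 0 < b)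
    (s : ℕ → Space d) (n : ℕ) (v : Fin n → ℝ) :
    Integrable (fun f : Space d => Real.exp (-b * (f ⬝ᵥ f)) * spectralWeight s n v f *
      (((2 * Real.pi) ^ d)⁻¹ * ∫ u, k u * Real.cos (f ⬝ᵥ u))) ∧
    ∫ f : Space d, Real.exp (-b * (f ⬝ᵥ f)) * spectralWeight s n v f *
      (((2 * Real.pi) ^ d)⁻¹ * ∫ u, k u * Real.cos (f ⬝ᵥ u)) ≤
      ∑ i, ∑ j, v i * v j * k (s i - s j) := by
  set q := ∑ i, ∑ j, v i * v j * k (s i - s j) with hq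
  have e : ∀ f : Space d, Real.exp (-b * (f ⬝ᵥ f)) * spectralWeight s n v f *
      (((2 * Real.pi) ^ d)⁻¹ * ∫ u, k u * Real.cos (f ⬝ᵥ u)) =
      ((2 * Real.pi) ^ d)⁻¹ * ∑ i, ∑ j, v i * v j * (Real.exp (-b * (f ⬝ᵥ f)) *
        (Real.cos (f ⬝ᵥ (s i - s j)) * ∫ u, k u * Real.cos (f ⬝ᵥ u))) := by
    intro f
    simp only [spectralWeight, Finset.mul_sum, Finset.sum_mul]
    exact Finset.sum_congr rfl fun i _ => Finset.sum_congr rfl fun j _ => by ring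
  have hint : ∀ i j : Fin n, Integrable (fun f : Space d => v i * v j * (Real.exp (-b * (f ⬝ᵥ f)) *
        (Real.cos (f ⬝ᵥ (s i - s j)) * ∫ u, k u * Real.cos (f ⬝ᵥ u)))) :=
    fun i j => (integrable_spectral hki hb (s i - s j)).const_mul _
  -- The Gaussian `G t = exp (-|t|² / (4 b))` has integral `(4 π b) ^ (d / 2)`.
  have hb4 : 0 < 1 / (4 * b) := by positivity
  have hGe : ∀ t : Space d, Real.exp (-(t ⬝ᵥ t) / (4 * b)) = Real.exp (-(1 / (4 * b)) * (t ⬝ᵥ t)) :=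
    fun t => by congr 1; ring
  have hG : Integrable (fun t : Space d => Real.exp (-(t ⬝ᵥ t) / (4 * b))) := by
    simp_rw [hGe]; exact integrable_gaussian hb4
  have hGint : (Real.pi / b) ^ ((d : ℝ) / 2) * ∫ t : Space d, Real.exp (-(t ⬝ᵥ t) / (4 * b)) =
      (2 * Real.pi) ^ d := by
    have h := integral_gaussian_mul_cos hb4 (0 : Space d)
    simp only [dotProduct_zero, Real.cos_zero, mul_one, neg_zero, zero_div, Real.exp_zero] at h
    simp_rw [hGe]
    rw [h, ← Real.mul_rpow (by positivity) (by positivity),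
      show Real.pi / b * (Real.pi / (1 / (4 * b))) = (2 * Real.pi) ^ (2 : ℝ) by
        rw [Real.rpow_two]; field_simp; norm_num, ← Real.rpow_mul (by positivity),
      ← Real.rpow_natCast]
    congr 1; ring
  have hkG : ∀ x : Space d, Integrable (fun t => k (x + t) * Real.exp (-(t ⬝ᵥ t) / (4 * b))) := by
    intro x
    refine (hki.comp_add_left x).mul_bdd (c := 1) hG.aestronglyMeasurable
      (Eventually.of_forall fun t => ?_)
    rw [Real.norm_eq_abs, Real.abs_exp, Real.exp_le_one_iff]
    have : 0 ≤ t ⬝ᵥ t := Finset.sum_nonneg fun i _ => mul_self_nonneg _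
    exact div_nonpos_of_nonpos_of_nonneg (by linarith) (by positivity)
  have hle : ∑ i, ∑ j, v i * v j * ∫ t, k (s i - s j + t) * Real.exp (-(t ⬝ᵥ t) / (4 * b)) ≤
      q * ∫ t : Space d, Real.exp (-(t ⬝ᵥ t) / (4 * b)) := by
    simp_rw [← integral_const_mul]
    have hint2 : ∀ i j : Fin n, Integrable (fun t => v i * v j *
        (k (s i - s j + t) * Real.exp (-(t ⬝ᵥ t) / (4 * b)))) := fun i j => (hkG _).const_mul _
    simp_rw [← integral_finsetSum _ fun j _ => hint2 _ j]
    rw [← integral_finsetSum _ fun i _ => integrable_finsetSum _ fun j _ => hint2 i j]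
    refine integral_mono (integrable_finsetSum _ fun i _ => integrable_finsetSum _ fun j _ => hint2 i j)
      (hG.const_mul q) fun t => ?_
    have := mul_le_mul_of_nonneg_right (hk.quadForm_add_le s n v t)
      (Real.exp_pos (-(t ⬝ᵥ t) / (4 * b))).le
    simpa only [hq, Finset.sum_mul, mul_assoc] using this
  constructor
  · simp_rw [e]
    exact (integrable_finsetSum _ fun i _ => integrable_finsetSum _ fun j _ => hint i j).const_mul _
  · simp_rw [e]
    rw [integral_const_mul, integral_finsetSum _ fun i _ => integrable_finsetSum _ fun j _ => hint i j]
    simp_rw [integral_finsetSum _ fun j _ => hint _ j, integral_const_mul,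
      ← integral_add_mul_gaussian hki hsin hb]
    rw [inv_mul_le_iff₀ (by positivity)]
    calc _ = (Real.pi / b) ^ ((d : ℝ) / 2) * ∑ i, ∑ j, v i * v j *
          ∫ t, k (s i - s j + t) * Real.exp (-(t ⬝ᵥ t) / (4 * b)) := by
          simp only [Finset.mul_sum]
          exact Finset.sum_congr rfl fun i _ => Finset.sum_congr rfl fun j _ => by ring
      _ ≤ (Real.pi / b) ^ ((d : ℝ) / 2) * (q * ∫ t : Space d, Real.exp (-(t ⬝ᵥ t) / (4 * b))) := by
          gcongr
      _ = (2 * Real.pi) ^ d * q := by rw [← hGint]; ring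

/-- Narrow Gaussian kernel matrices are within `1 / 2` of the identity as quadratic forms. -/
theorem WellSeparated.gaussian_quadForm_bounds {d : ℕ} {s : ℕ → Space d} (hs : WellSeparated s) :
    ∃ b₀ : ℝ, 0 < b₀ ∧ ∀ b, 0 < b → b ≤ b₀ → ∀ (n : ℕ) (v : Fin n → ℝ),
      |∑ i, ∑ j, v i * v j * Real.exp (-((s i - s j) ⬝ᵥ (s i - s j)) / (4 * b)) - v ⬝ᵥ v| ≤
        1 / 2 * (v ⬝ᵥ v) := by
  obtain ⟨b₀, hb₀, h⟩ := hs.exists_sum_gaussian_le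
  refine ⟨b₀, hb₀, fun b hb hbb n v => ?_⟩
  set g : Fin n → Fin n → ℝ := fun i j => Real.exp (-((s i - s j) ⬝ᵥ (s i - s j)) / (4 * b)) with hg
  have hsymm : ∀ i j, g i j = g j i := by
    intro i j
    simp only [hg]
    rw [← neg_sub (s j) (s i), neg_dotProduct_neg]
  have hrow : ∀ i : Fin n, ∑ j ∈ Finset.univ.erase i, g i j ≤ 1 / 2 := by
    intro i
    have := h b hb hbb i ((Finset.univ.erase i).map Fin.valEmbedding) (by simp)
    rwa [Finset.sum_map] at this
  have e : ∑ i, ∑ j, v i * v j * g i j - v ⬝ᵥ v =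
      ∑ i, ∑ j ∈ Finset.univ.erase i, v i * v j * g i j := by
    rw [dotProduct, ← Finset.sum_sub_distrib]
    refine Finset.sum_congr rfl fun i _ => ?_
    rw [← Finset.add_sum_erase _ _ (Finset.mem_univ i)]
    simp [hg]
  rw [e]
  have hpt : ∀ i j, |v i * v j * g i j| ≤ 1 / 2 * (v i * v i * g i j) + 1 / 2 * (v j * v j * g j i) := by
    intro i j
    have hgp : 0 < g i j := Real.exp_pos _
    rw [hsymm j i, abs_mul, abs_of_pos hgp, abs_mul]
    have := two_mul_le_add_sq |v i| |v j|
    rw [sq_abs, sq_abs] at this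
    nlinarith
  have hmain : ∑ i, ∑ j ∈ Finset.univ.erase i, v i * v i * g i j ≤ 1 / 2 * (v ⬝ᵥ v) := by
    rw [dotProduct, Finset.mul_sum]
    refine Finset.sum_le_sum fun i _ => ?_
    rw [← Finset.mul_sum, mul_comm]
    exact mul_le_mul_of_nonneg_right (hrow i) (mul_self_nonneg _)
  have hswap : ∑ i, ∑ j ∈ Finset.univ.erase i, v j * v j * g j i =
      ∑ i, ∑ j ∈ Finset.univ.erase i, v i * v i * g i j :=
    Finset.sum_comm' (by intro x y; simp [eq_comm])
  calc _ ≤ ∑ i, ∑ j ∈ Finset.univ.erase i, |v i * v j * g i j| :=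
        (Finset.abs_sum_le_sum_abs _ _).trans
          (Finset.sum_le_sum fun i _ => Finset.abs_sum_le_sum_abs _ _)
    _ ≤ ∑ i, ∑ j ∈ Finset.univ.erase i,
          (1 / 2 * (v i * v i * g i j) + 1 / 2 * (v j * v j * g j i)) :=
        Finset.sum_le_sum fun i _ => Finset.sum_le_sum fun j _ => hpt i j
    _ = 1 / 2 * (∑ i, ∑ j ∈ Finset.univ.erase i, v i * v i * g i j) +
        1 / 2 * (∑ i, ∑ j ∈ Finset.univ.erase i, v j * v j * g j i) := by
        simp only [Finset.sum_add_distrib, Finset.mul_sum]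
    _ ≤ _ := by rw [hswap]; linarith

/-- Covariance matrices over a well-separated sequence are uniformly coercive if the Fourier
transforms are jointly continuous and positive over a compact parameter set. -/
theorem FourierPositive.exists_quadForm_ge {d p : ℕ} {Θ : Set (Param p)} (hΘ : IsCompact Θ)
    {k : Param p → Space d → ℝ} (hF : FourierPositive Θ k) (hk : ∀ θ ∈ Θ, IsStationaryCovariance (k θ))
    {s : ℕ → Space d} (hs : WellSeparated s) :
    ∃ a : ℝ, 0 < a ∧ ∀ θ ∈ Θ, ∀ (n : ℕ) (v : Fin n → ℝ),
      a * (v ⬝ᵥ v) ≤ v ⬝ᵥ (covMatrix (k θ) s n).mulVec v := by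
  obtain ⟨b, hb, hbb⟩ := hs.gaussian_quadForm_bounds
  -- `L` is so large that the part of the damped spectral weight beyond frequency `L` is small.
  obtain ⟨L, hL0, hL⟩ : ∃ L : ℝ, 0 < L ∧
      Real.exp (-b * L ^ 2 / 2) * ((Real.pi / (b / 2)) ^ ((d : ℝ) / 2) * (3 / 2)) ≤
        (Real.pi / b) ^ ((d : ℝ) / 2) / 4 := by
    have h1 : Tendsto (fun L : ℝ => Real.exp (-b * L ^ 2 / 2) *
        ((Real.pi / (b / 2)) ^ ((d : ℝ) / 2) * (3 / 2))) atTop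
        (𝓝 (0 * ((Real.pi / (b / 2)) ^ ((d : ℝ) / 2) * (3 / 2)))) := by
      refine Tendsto.mul_const _ (Real.tendsto_exp_atBot.comp ?_)
      have : (fun L : ℝ => -b * L ^ 2 / 2) = fun L : ℝ => (-b / 2) * L ^ 2 := by ext; ring
      rw [this]
      exact (tendsto_pow_atTop two_ne_zero).const_mul_atTop_of_neg (by linarith)
    rw [zero_mul] at h1
    have h2 := h1.eventually_le_const
      (show 0 < (Real.pi / b) ^ ((d : ℝ) / 2) / 4 by have := Real.pi_pos; positivity)
    obtain ⟨L, h3, h4⟩ := (h2.and (eventually_gt_atTop 0)).exists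
    exact ⟨L, h4, h3⟩
  obtain ⟨m, hm, hmF⟩ : ∃ m : ℝ, 0 < m ∧ ∀ θ ∈ Θ, ∀ f : Space d, ‖f‖ ≤ L →
      m ≤ (fourierTransform (k θ) f).re := by
    have hK : IsCompact (Θ ×ˢ Metric.closedBall (0 : Space d) L) := hΘ.prod (isCompact_closedBall _ _)
    have hc : ContinuousOn (fun q : Param p × Space d => (fourierTransform (k q.1) q.2).re)
        (Θ ×ˢ Metric.closedBall (0 : Space d) L) :=
      Complex.continuous_re.comp_continuousOn
        (hF.continuousOn.mono (Set.prod_mono subset_rfl (Set.subset_univ _)))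
    rcases Θ.eq_empty_or_nonempty with he | hne
    · exact ⟨1, one_pos, by simp [he]⟩
    · obtain ⟨q, hq, hmin⟩ := hK.exists_isMinOn
        (hne.prod ⟨0, Metric.mem_closedBall_self hL0.le⟩) hc
      refine ⟨_, (hF.pos q.1 hq.1 q.2).1, fun θ hθ f hf => ?_⟩
      exact hmin (Set.mk_mem_prod hθ (by simpa using hf) : (θ, f) ∈ _)
  have hpi := Real.pi_pos
  -- Half of the Gaussian mass is left by the off-diagonal terms, and a quarter goes to the tail.
  refine ⟨m * ((Real.pi / b) ^ ((d : ℝ) / 2) / 4), by positivity, fun θ hθ n v => ?_⟩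
  have hki : Integrable (k θ) := integrable_of_fourierTransform_pos (hF.pos θ hθ 0).1
  have hsin : ∀ f : Space d, ∫ u, k θ u * Real.sin (f ⬝ᵥ u) = 0 := by
    intro f
    have h1 := (hF.pos θ hθ f).2
    rw [(fourierTransform_eq hki f).2, neg_eq_zero, mul_eq_zero] at h1
    exact h1.resolve_left (by positivity)
  obtain ⟨hI, hle⟩ := (hk θ hθ).integral_spectral_le hki hsin hb s n v
  rw [covMatrix_quadForm]
  refine le_trans ?_ hle
  have hE := Real.exp_pos (-b * L ^ 2 / 2)
  -- Beyond frequency `L` the left-hand side is nonpositive, so no lower bound on the Fourier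
  -- transform is needed there.
  have hlow : ∀ f : Space d, m * (Real.exp (-b * (f ⬝ᵥ f)) * spectralWeight s n v f) -
      m * Real.exp (-b * L ^ 2 / 2) * (Real.exp (-(b / 2) * (f ⬝ᵥ f)) * spectralWeight s n v f) ≤
      Real.exp (-b * (f ⬝ᵥ f)) * spectralWeight s n v f *
      (((2 * Real.pi) ^ d)⁻¹ * ∫ u, k θ u * Real.cos (f ⬝ᵥ u)) := by
    intro f
    rw [← (fourierTransform_eq hki f).1]
    have hw := spectralWeight_nonneg s n v f
    have hpos := (hF.pos θ hθ f).1
    rcases le_or_gt ‖f‖ L with hf | hf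
    · have h1 := hmF θ hθ f hf
      have h2 : 0 ≤ Real.exp (-b * (f ⬝ᵥ f)) * spectralWeight s n v f := by positivity
      have h3 : 0 ≤ m * Real.exp (-b * L ^ 2 / 2) *
        (Real.exp (-(b / 2) * (f ⬝ᵥ f)) * spectralWeight s n v f) := by positivity
      nlinarith
    · have hsq : L ^ 2 ≤ f ⬝ᵥ f := by
        obtain ⟨i, hi⟩ : ∃ i, L < ‖f i‖ := by
          by_contra hcon
          push Not at hcon
          exact absurd ((pi_norm_le_iff_of_nonneg hL0.le).2 hcon) (not_le.2 hf)
        calc L ^ 2 ≤ ‖f i‖ ^ 2 := by gcongr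
          _ = f i * f i := by rw [Real.norm_eq_abs, sq_abs, sq]
          _ ≤ f ⬝ᵥ f := Finset.single_le_sum (f := fun k => f k * f k)
              (fun k _ => mul_self_nonneg _) (Finset.mem_univ i)
      have h1 : Real.exp (-b * (f ⬝ᵥ f)) ≤
          Real.exp (-b * L ^ 2 / 2) * Real.exp (-(b / 2) * (f ⬝ᵥ f)) := by
        rw [← Real.exp_add, Real.exp_le_exp]
        nlinarith
      have h2 : m * (Real.exp (-b * (f ⬝ᵥ f)) * spectralWeight s n v f) ≤
          m * Real.exp (-b * L ^ 2 / 2) * (Real.exp (-(b / 2) * (f ⬝ᵥ f)) * spectralWeight s n v f) := by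
        calc _ ≤ m * ((Real.exp (-b * L ^ 2 / 2) * Real.exp (-(b / 2) * (f ⬝ᵥ f))) *
              spectralWeight s n v f) := by gcongr
          _ = _ := by ring
      have h3 : 0 ≤ Real.exp (-b * (f ⬝ᵥ f)) * spectralWeight s n v f *
        (fourierTransform (k θ) f).re := by positivity
      linarith
  have hb2 : 0 < b / 2 := by positivity
  have hA := integrable_gaussian_mul_spectralWeight hb s n v
  have hB := integrable_gaussian_mul_spectralWeight hb2 s n v
  have hmono := integral_mono ((hA.const_mul m).sub (hB.const_mul (m * Real.exp (-b * L ^ 2 / 2)))) hI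
    hlow
  refine le_trans ?_ hmono
  have hsplit := integral_sub (hA.const_mul m) (hB.const_mul (m * Real.exp (-b * L ^ 2 / 2)))
  simp only [Pi.sub_apply] at hsplit ⊢
  rw [hsplit, integral_const_mul, integral_const_mul,
    integral_gaussian_mul_spectralWeight hb, integral_gaussian_mul_spectralWeight hb2]
  have h1 := abs_le.1 (hbb b hb le_rfl n v)
  have h2 := abs_le.1 (hbb (b / 2) hb2 (by linarith) n v)
  set X := ∑ i, ∑ j, v i * v j * Real.exp (-((s i - s j) ⬝ᵥ (s i - s j)) / (4 * b))
  set X' := ∑ i, ∑ j, v i * v j * Real.exp (-((s i - s j) ⬝ᵥ (s i - s j)) / (4 * (b / 2)))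
  have hvv : 0 ≤ v ⬝ᵥ v := Finset.sum_nonneg fun i _ => mul_self_nonneg _
  set c1 := (Real.pi / b) ^ ((d : ℝ) / 2) with hc1
  set c2 := (Real.pi / (b / 2)) ^ ((d : ℝ) / 2) with hc2
  have hc1p : 0 < c1 := by positivity
  have hc2p : 0 < c2 := by positivity
  have h3 : c1 * (1 / 2 * (v ⬝ᵥ v)) ≤ c1 * X := by gcongr; linarith [h1.1]
  have h4 : Real.exp (-b * L ^ 2 / 2) * (c2 * X') ≤ c1 / 4 * (v ⬝ᵥ v) := by
    calc _ ≤ Real.exp (-b * L ^ 2 / 2) * (c2 * (3 / 2 * (v ⬝ᵥ v))) := by gcongr; linarith [h2.2]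
      _ = (Real.exp (-b * L ^ 2 / 2) * (c2 * (3 / 2))) * (v ⬝ᵥ v) := by ring
      _ ≤ _ := by gcongr
  calc m * (c1 / 4) * (v ⬝ᵥ v) = m * (c1 * (1 / 2 * (v ⬝ᵥ v)) - c1 / 4 * (v ⬝ᵥ v)) := by ring
    _ ≤ m * (c1 * X - Real.exp (-b * L ^ 2 / 2) * (c2 * X')) := by gcongr
    _ = _ := by ring

/-! ### Decorrelation of transformed Gaussian sequences -/

theorem exp_mul_add_four_le (a x y z w : ℝ) :
    Real.exp (a * (x + y + z + w)) ≤
      (Real.exp (4 * a * x) + Real.exp (4 * a * y) + Real.exp (4 * a * z) + Real.exp (4 * a * w)) / 4 := by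
  have e : ∀ x, Real.exp (4 * a * x) = Real.exp (a * x) ^ 4 := fun x => by
    rw [← Real.exp_nat_mul]; ring_nf
  rw [e, e, e, e, mul_add, mul_add, mul_add, Real.exp_add, Real.exp_add, Real.exp_add]
  set p := Real.exp (a * x)
  set q := Real.exp (a * y)
  set r := Real.exp (a * z)
  set t := Real.exp (a * w)
  nlinarith [sq_nonneg (p ^ 2 - q ^ 2), sq_nonneg (r ^ 2 - t ^ 2), sq_nonneg (p * q - r * t)]

/-- A centred Gaussian sequence of constant variance `v`, with covariances `κ i j`, in which any two
distinct members stay at least `c` away from being perfectly correlated. -/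
structure GaussianSequence {Ω : Type*} [MeasurableSpace Ω] (P : Measure Ω) (X : ℕ → Ω → ℝ)
    (κ : ℕ → ℕ → ℝ) (v c : ℝ) : Prop where
  gaussian : IsGaussianProcess X P
  mean : ∀ i, ∫ ω, X i ω ∂P = 0
  cov : ∀ i j, cov[X i, X j; P] = κ i j
  diag : ∀ i, κ i i = v
  pos : 0 < c
  le_diag : c ≤ v
  gap : ∀ i j, i ≠ j → |κ i j| + c ≤ v

namespace GaussianSequence

variable {Ω : Type*} [MeasurableSpace Ω] {P : Measure Ω} {X : ℕ → Ω → ℝ}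
  {κ : ℕ → ℕ → ℝ} {v c : ℝ}

theorem symm (h : GaussianSequence P X κ v c) (i j : ℕ) : κ i j = κ j i := by
  rw [← h.cov, ← h.cov, covariance_comm]

theorem map_eq (h : GaussianSequence P X κ v c) (i : ℕ) :
    P.map (X i) = gaussianReal 0 v.toNNReal := by
  have := (h.gaussian.hasGaussianLaw_eval i).map_eq_gaussianReal
  rw [this, h.mean i, ← covariance_self (h.gaussian.aemeasurable i), h.cov, h.diag]

theorem integrable_exp_abs (h : GaussianSequence P X κ v c) (t : ℝ) (i : ℕ) :
    Integrable (fun ω => Real.exp (t * |X i ω|)) P := by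
  have h1 : ∀ t : ℝ, Integrable (fun x => Real.exp (t * x)) (P.map (X i)) := by
    intro t; rw [h.map_eq]; exact integrable_exp_mul_gaussianReal t
  have h2 := integrable_exp_mul_abs (h1 t) (h1 (-t))
  exact (integrable_map_measure h2.aestronglyMeasurable (h.gaussian.aemeasurable i)).1 h2

theorem integral_exp_abs (h : GaussianSequence P X κ v c) (t : ℝ) (i : ℕ) :
    ∫ ω, Real.exp (t * |X i ω|) ∂P = ∫ x, Real.exp (t * |x|) ∂gaussianReal 0 v.toNNReal := by
  rw [← h.map_eq i, integral_map (h.gaussian.aemeasurable i)]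
  exact (by fun_prop : Continuous fun x : ℝ => Real.exp (t * |x|)).aestronglyMeasurable

/-- The sum of the moduli of four members of the sequence. -/
def absSum {Ω : Type*} (X : ℕ → Ω → ℝ) (i j k l : ℕ) (ω : Ω) : ℝ := |X i ω| + |X j ω| + |X k ω| + |X l ω|

theorem absSum_nonneg {Ω : Type*} {X : ℕ → Ω → ℝ} (i j k l : ℕ) (ω : Ω) : 0 ≤ absSum X i j k l ω := by
  unfold absSum; positivity

theorem integrable_exp_absSum (h : GaussianSequence P X κ v c) (a : ℝ) (i j k l : ℕ) :
    Integrable (fun ω => Real.exp (a * absSum X i j k l ω)) P := by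
  have hi := fun m => h.integrable_exp_abs (4 * a) m
  refine ((((hi i).add (hi j)).add (hi k)).add (hi l)).div_const 4 |>.mono' ?_
    (Eventually.of_forall fun ω => ?_)
  · have hm := fun m => h.gaussian.aemeasurable m
    unfold absSum
    exact (Real.measurable_exp.comp_aemeasurable ((((((hm i).abs).add (hm j).abs).add (hm k).abs).add
      (hm l).abs).const_mul a)).aestronglyMeasurable
  · rw [Real.norm_eq_abs, Real.abs_exp]
    exact exp_mul_add_four_le a _ _ _ _

theorem integral_exp_absSum_le (h : GaussianSequence P X κ v c) (a : ℝ) (i j k l : ℕ) :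
    ∫ ω, Real.exp (a * absSum X i j k l ω) ∂P ≤
      ∫ x, Real.exp (4 * a * |x|) ∂gaussianReal 0 v.toNNReal := by
  have hi := fun m => h.integrable_exp_abs (4 * a) m
  have h1 := integral_mono (h.integrable_exp_absSum a i j k l)
    (((((hi i).add (hi j)).add (hi k)).add (hi l)).div_const 4)
    (fun ω => exp_mul_add_four_le a |X i ω| |X j ω| |X k ω| |X l ω|)
  refine h1.trans (le_of_eq ?_)
  rw [integral_div, integral_add' (((hi i).add (hi j)).add (hi k)) (hi l),
    integral_add' ((hi i).add (hi j)) (hi k), integral_add' (hi i) (hi j)]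
  simp only [h.integral_exp_abs]
  ring

/-- The best linear predictor of any member from two others, with coefficients controlled by the
covariances. The normal equations are solved by Cramer's rule, the determinant being at least
`c ^ 2`. -/
theorem exists_regression (h : GaussianSequence P X κ v c) : ∃ B : ℝ, 0 < B ∧ ∀ i j k : ℕ,
    ∃ b₁ b₂ : ℝ, |b₁| ≤ B * (|κ i k| + |κ j k|) ∧ |b₂| ≤ B * (|κ i k| + |κ j k|) ∧
      κ i k = b₁ * v + b₂ * κ i j ∧ κ j k = b₁ * κ i j + b₂ * v := by
  have hc := h.pos
  have hv : 0 < v := hc.trans_le h.le_diag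
  refine ⟨v / c ^ 2, by positivity, fun i j k => ?_⟩
  have hcv : c ^ 2 ≤ v * v := by nlinarith [h.le_diag]
  rcases eq_or_ne i j with rfl | hij
  · refine ⟨κ i k / v, 0, ?_, by simp; positivity, ?_, ?_⟩
    · rw [abs_div, abs_of_pos hv, div_mul_eq_mul_div, div_le_div_iff₀ hv (by positivity)]
      nlinarith [abs_nonneg (κ i k)]
    · field_simp; ring
    · rw [h.diag]; field_simp; ring
  · have hg := h.gap i j hij
    have hk0 := abs_nonneg (κ i j)
    set D := v ^ 2 - κ i j ^ 2 with hD
    have hDc : c ^ 2 ≤ D := by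
      have : D = (v - |κ i j|) * (v + |κ i j|) := by
        rw [hD, ← sq_abs (κ i j)]; ring
      rw [this]; nlinarith
    have hDpos : 0 < D := lt_of_lt_of_le (by positivity) hDc
    have key : ∀ x y : ℝ, |(v * x - κ i j * y) / D| ≤ v / c ^ 2 * (|x| + |y|) := by
      intro x y
      rw [abs_div, abs_of_pos hDpos, div_mul_eq_mul_div, div_le_div_iff₀ hDpos (by positivity)]
      have h1 : |v * x - κ i j * y| ≤ v * (|x| + |y|) := by
        calc _ ≤ |v * x| + |κ i j * y| := abs_sub _ _
          _ = v * |x| + |κ i j| * |y| := by rw [abs_mul, abs_mul, abs_of_pos hv]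
          _ ≤ v * |x| + v * |y| := by gcongr; linarith
          _ = _ := by ring
      calc _ ≤ v * (|x| + |y|) * c ^ 2 := by gcongr
        _ ≤ _ := by gcongr
    refine ⟨(v * κ i k - κ i j * κ j k) / D, (v * κ j k - κ i j * κ i k) / D, key _ _, ?_, ?_, ?_⟩
    · rw [add_comm |κ i k|]; exact key _ _
    · field_simp; rw [hD]; ring
    · field_simp; rw [hD]; ring

/-- Residuals uncorrelated with two members of the sequence are independent of them. -/
theorem indepFun_residual [IsProbabilityMeasure P] (h : GaussianSequence P X κ v c) {i j k l : ℕ} {a₁ a₂ b₁ b₂ : ℝ}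
    (ha₁ : κ i k = a₁ * v + a₂ * κ i j) (ha₂ : κ j k = a₁ * κ i j + a₂ * v)
    (hb₁ : κ i l = b₁ * v + b₂ * κ i j) (hb₂ : κ j l = b₁ * κ i j + b₂ * v) :
    IndepFun (fun ω (m : Fin 2) => (![X i, X j] m) ω)
      (fun ω (m : Fin 2) => (![fun ω => X k ω - (a₁ * X i ω + a₂ * X j ω),
        fun ω => X l ω - (b₁ * X i ω + b₂ * X j ω)] m) ω) P := by
  classical
  have hL : ∀ m, MemLp (X m) 2 P := fun m => (h.gaussian.hasGaussianLaw_eval m).memLp_two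
  have hcov : ∀ (p q : ℕ) (x y : ℝ), cov[X p, fun ω => X q ω - (x * X i ω + y * X j ω); P] =
      κ p q - (x * κ p i + y * κ p j) := by
    intro p q x y
    refine (covariance_fun_sub_right (hL p) (hL q)
      (((hL i).const_mul x).add ((hL j).const_mul y))).trans ?_
    rw [covariance_add_right (hL p) ((hL i).const_mul x) ((hL j).const_mul y),
      covariance_const_mul_right, covariance_const_mul_right, h.cov, h.cov, h.cov]
  refine HasGaussianLaw.indepFun_of_covariance_eval ?_ ?_
  · let I : Finset ℕ := {i, j, k, l}
    let π : ∀ m, m ∈ I → (I → ℝ) →L[ℝ] ℝ := fun m hmem => ContinuousLinearMap.proj ⟨m, hmem⟩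
    have hi : i ∈ I := by simp [I]
    have hj : j ∈ I := by simp [I]
    have hk : k ∈ I := by simp [I]
    have hl : l ∈ I := by simp [I]
    let L : (I → ℝ) →L[ℝ] (Fin 2 → ℝ) × (Fin 2 → ℝ) :=
      (ContinuousLinearMap.pi ![π i hi, π j hj]).prod
        (ContinuousLinearMap.pi ![π k hk - (a₁ • π i hi + a₂ • π j hj),
          π l hl - (b₁ • π i hi + b₂ • π j hj)])
    convert! (h.gaussian.hasGaussianLaw I).map_fun L using 2 with ω
    refine Prod.ext (funext fun m => ?_) (funext fun m => ?_) <;> fin_cases m <;> simp [L, π]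
  · intro p q
    fin_cases p <;> fin_cases q <;> simp [hcov, h.diag, h.symm j i] <;> linarith

/-- Functions of exponential growth in four members of the sequence are square integrable. -/
theorem memLp_of_le (h : GaussianSequence P X κ v c) {F : Ω → ℝ} (hF : AEStronglyMeasurable F P)
    {D a : ℝ} {i j k l : ℕ} (hb : ∀ ω, |F ω| ≤ D * Real.exp (a * absSum X i j k l ω)) :
    MemLp F 2 P := by
  rw [memLp_two_iff_integrable_sq hF]
  refine ((h.integrable_exp_absSum (2 * a) i j k l).const_mul (D ^ 2)).mono' (hF.pow 2)
    (Eventually.of_forall fun ω => ?_)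
  rw [Real.norm_eq_abs, abs_pow]
  calc |F ω| ^ 2 ≤ (D * Real.exp (a * absSum X i j k l ω)) ^ 2 := by gcongr; exact hb ω
    _ = _ := by rw [mul_pow, ← Real.exp_nat_mul]; ring_nf

/-- A covariance bound by exponential moments of the moduli. -/
theorem abs_covariance_le [IsProbabilityMeasure P] (h : GaussianSequence P X κ v c) {F G : Ω → ℝ}
    (hF : AEStronglyMeasurable F P) (hG : AEStronglyMeasurable G P) {D E a b : ℝ} {i j k l : ℕ}
    (hbF : ∀ ω, |F ω| ≤ D * Real.exp (a * absSum X i j k l ω))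
    (hbG : ∀ ω, |G ω| ≤ E * Real.exp (b * absSum X i j k l ω))
    (ha : 0 ≤ a) (hb : 0 ≤ b) {N : ℝ} (hN : ∫ ω, Real.exp ((a + b) * absSum X i j k l ω) ∂P ≤ N) :
    |cov[F, G; P]| ≤ D * E * (N + N ^ 2) := by
  have hFL := h.memLp_of_le hF hbF
  have hGL := h.memLp_of_le hG hbG
  have hΩ : Nonempty Ω := nonempty_of_isProbabilityMeasure P
  have hD : 0 ≤ D := by
    obtain ⟨ω⟩ := hΩ
    exact nonneg_of_mul_nonneg_left ((abs_nonneg _).trans (hbF ω)) (Real.exp_pos _)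
  have hE : 0 ≤ E := by
    obtain ⟨ω⟩ := hΩ
    exact nonneg_of_mul_nonneg_left ((abs_nonneg _).trans (hbG ω)) (Real.exp_pos _)
  have hI := fun t => h.integrable_exp_absSum t i j k l
  have hN0 : 0 ≤ N := (integral_nonneg fun ω => (Real.exp_pos _).le).trans hN
  have hmono : ∀ t, t ≤ a + b → ∫ ω, Real.exp (t * absSum X i j k l ω) ∂P ≤ N := by
    intro t ht
    refine (integral_mono (hI t) (hI (a + b)) fun ω => ?_).trans hN
    have := absSum_nonneg (X := X) i j k l ω
    simp only [Real.exp_le_exp]; gcongr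
  have h1 : |∫ ω, F ω * G ω ∂P| ≤ D * E * N := by
    rw [← Real.norm_eq_abs]
    calc _ ≤ ∫ ω, (D * E) * Real.exp ((a + b) * absSum X i j k l ω) ∂P := by
          refine norm_integral_le_of_norm_le ((hI _).const_mul _) (Eventually.of_forall fun ω => ?_)
          rw [Real.norm_eq_abs, abs_mul, add_mul, Real.exp_add]
          calc _ ≤ (D * Real.exp (a * absSum X i j k l ω)) * (E * Real.exp (b * absSum X i j k l ω)) :=
                mul_le_mul (hbF ω) (hbG ω) (abs_nonneg _) ((abs_nonneg _).trans (hbF ω))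
            _ = _ := by ring
      _ ≤ _ := by rw [integral_const_mul]; gcongr
  have h2 : |∫ ω, F ω ∂P| ≤ D * N := by
    rw [← Real.norm_eq_abs]
    refine (norm_integral_le_of_norm_le ((hI a).const_mul D) (Eventually.of_forall hbF)).trans ?_
    rw [integral_const_mul]
    exact mul_le_mul_of_nonneg_left (hmono a (by linarith)) hD
  have h3 : |∫ ω, G ω ∂P| ≤ E * N := by
    rw [← Real.norm_eq_abs]
    refine (norm_integral_le_of_norm_le ((hI b).const_mul E) (Eventually.of_forall hbG)).trans ?_
    rw [integral_const_mul]
    exact mul_le_mul_of_nonneg_left (hmono b (by linarith)) hE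
  rw [covariance_eq_sub hFL hGL]
  calc _ ≤ |∫ ω, F ω * G ω ∂P| + |∫ ω, F ω ∂P| * |∫ ω, G ω ∂P| := by
        rw [← abs_mul]; exact abs_sub _ _
    _ ≤ D * E * N + (D * N) * (E * N) := by gcongr
    _ = _ := by ring

end GaussianSequence

theorem abs_sub_le_of_exp_bound {T : ℝ → ℝ} (hT : ContDiff ℝ 1 T) {C : ℝ} (hC : 0 ≤ C)
    (hb : ∀ t, |deriv T t| ≤ C * Real.exp (C * |t|)) {x y S : ℝ} (hx : |x| ≤ S) (hy : |y| ≤ S) :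
    |T x - T y| ≤ C * Real.exp (C * S) * |x - y| := by
  have h := Convex.norm_image_sub_le_of_norm_deriv_le (f := T) (s := Set.Icc (-S) S)
    (C := C * Real.exp (C * S)) (fun t _ => (hT.differentiable one_ne_zero) t)
    (fun t ht => ?_) (convex_Icc _ _) (abs_le.1 hy) (abs_le.1 hx)
  · simpa [Real.norm_eq_abs] using h
  · refine (hb t).trans ?_
    have := abs_le.2 ht
    gcongr

namespace GaussianSequence

variable {Ω : Type*} [MeasurableSpace Ω] {P : Measure Ω} {X : ℕ → Ω → ℝ}
  {κ : ℕ → ℕ → ℝ} {v c : ℝ}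

theorem memLp_mul (h : GaussianSequence P X κ v c) {T : ℝ → ℝ} (hT : ContDiff ℝ 1 T) {C : ℝ}
    (hb : ∀ t, |T t| ≤ C * Real.exp (C * |t|)) (i j : ℕ) :
    MemLp (fun ω => T (X i ω) * T (X j ω)) 2 P ∧ MemLp (fun ω => T (X i ω)) 2 P := by
  have hC : 0 ≤ C := by simpa using (abs_nonneg _).trans (hb 0)
  have hTm : ∀ m, AEMeasurable (fun ω => T (X m ω)) P :=
    fun m => hT.continuous.measurable.comp_aemeasurable (h.gaussian.aemeasurable m)
  have hbi : ∀ (m : ℕ) (S : ℝ) (ω : Ω), |X m ω| ≤ S → |T (X m ω)| ≤ C * Real.exp (C * S) := by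
    intro m S ω hS
    refine (hb _).trans ?_
    gcongr
  constructor
  · refine h.memLp_of_le (i := i) (j := j) (k := i) (l := j) (D := C ^ 2) (a := 2 * C)
      ((hTm i).mul (hTm j)).aestronglyMeasurable fun ω => ?_
    have h1 := hbi i (absSum X i j i j ω) ω (by unfold absSum; linarith [abs_nonneg (X i ω), abs_nonneg (X j ω)])
    have h2 := hbi j (absSum X i j i j ω) ω (by unfold absSum; linarith [abs_nonneg (X i ω), abs_nonneg (X j ω)])
    rw [abs_mul]
    calc _ ≤ (C * Real.exp (C * absSum X i j i j ω)) * (C * Real.exp (C * absSum X i j i j ω)) := by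
          gcongr
      _ = _ := by rw [mul_assoc 2, two_mul, Real.exp_add]; ring
  · exact h.memLp_of_le (i := i) (j := j) (k := i) (l := j) (D := C) (a := C)
      (hTm i).aestronglyMeasurable fun ω => hbi i _ ω
        (by unfold absSum; linarith [abs_nonneg (X i ω), abs_nonneg (X j ω)])

/-- Products of a smooth transformation of a Gaussian sequence decorrelate linearly in the
covariances of the sequence: replacing the second pair by its residuals given the first pair makes
the products independent, at the cost of a small `L²` error. -/
theorem exists_abs_covariance_mul_le [IsProbabilityMeasure P]
    (h : GaussianSequence P X κ v c) {T : ℝ → ℝ} (hT : ContDiff ℝ 1 T) {C : ℝ}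
    (hb : ∀ t, |T t| ≤ C * Real.exp (C * |t|) ∧ |deriv T t| ≤ C * Real.exp (C * |t|)) :
    ∃ D : ℝ, 0 < D ∧ ∀ i j k l : ℕ,
      |cov[fun ω => T (X i ω) * T (X j ω), fun ω => T (X k ω) * T (X l ω); P]| ≤
        D * (|κ i k| + |κ j k| + |κ i l| + |κ j l|) := by
  obtain ⟨B, hB, hreg⟩ := h.exists_regression
  have hC : 0 ≤ C := by simpa using (abs_nonneg _).trans (hb 0).1
  set N := ∫ x, Real.exp (4 * (4 * C + 1) * |x|) ∂gaussianReal 0 v.toNNReal with hNdef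
  have hN0 : 0 ≤ N := integral_nonneg fun x => (Real.exp_pos _).le
  refine ⟨2 * C ^ 4 * (N + N ^ 2) * B + 1, by positivity, fun i j k l => ?_⟩
  obtain ⟨a₁, a₂, ha₁, ha₂, hak, hal⟩ := hreg i j k
  obtain ⟨b₁, b₂, hb₁, hb₂, hbk, hbl⟩ := hreg i j l
  set Q := |κ i k| + |κ j k| + |κ i l| + |κ j l| with hQ
  have hQ0 : 0 ≤ Q := by positivity
  set ε := B * Q with hε
  have hε0 : 0 ≤ ε := by positivity
  have hle1 : |κ i k| + |κ j k| ≤ Q := by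
    rw [hQ]; linarith [abs_nonneg (κ i l), abs_nonneg (κ j l)]
  have hle2 : |κ i l| + |κ j l| ≤ Q := by
    rw [hQ]; linarith [abs_nonneg (κ i k), abs_nonneg (κ j k)]
  have ha₁' : |a₁| ≤ ε := ha₁.trans (by rw [hε]; gcongr)
  have ha₂' : |a₂| ≤ ε := ha₂.trans (by rw [hε]; gcongr)
  have hb₁' : |b₁| ≤ ε := hb₁.trans (by rw [hε]; gcongr)
  have hb₂' : |b₂| ≤ ε := hb₂.trans (by rw [hε]; gcongr)
  have hm := fun m => h.gaussian.aemeasurable m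
  have hTm : ∀ {f : Ω → ℝ}, AEMeasurable f P → AEMeasurable (fun ω => T (f ω)) P :=
    fun hf => hT.continuous.measurable.comp_aemeasurable hf
  set S := absSum X i j k l with hS
  have hSdef : ∀ ω, S ω = |X i ω| + |X j ω| + |X k ω| + |X l ω| := fun ω => rfl
  have hS0 : ∀ ω, 0 ≤ S ω := fun ω => absSum_nonneg i j k l ω
  have hbT : ∀ (x : ℝ) (ω : Ω), |x| ≤ S ω → |T x| ≤ C * Real.exp (C * S ω) := by
    intro x ω hx
    refine (hb x).1.trans ?_
    gcongr
  have hprod : ∀ (x y : ℝ) (ω : Ω), |x| ≤ S ω → |y| ≤ S ω →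
      |T x * T y| ≤ C ^ 2 * Real.exp ((2 * C) * S ω) := by
    intro x y ω hx hy
    rw [abs_mul]
    calc _ ≤ (C * Real.exp (C * S ω)) * (C * Real.exp (C * S ω)) := by
          gcongr
          · exact hbT x ω hx
          · exact hbT y ω hy
      _ = _ := by rw [mul_assoc 2, two_mul, Real.exp_add]; ring
  have hXi : ∀ ω, |X i ω| ≤ S ω := fun ω => by
    rw [hSdef]; linarith [abs_nonneg (X j ω), abs_nonneg (X k ω), abs_nonneg (X l ω)]
  have hXj : ∀ ω, |X j ω| ≤ S ω := fun ω => by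
    rw [hSdef]; linarith [abs_nonneg (X i ω), abs_nonneg (X k ω), abs_nonneg (X l ω)]
  have hXk : ∀ ω, |X k ω| ≤ S ω := fun ω => by
    rw [hSdef]; linarith [abs_nonneg (X j ω), abs_nonneg (X i ω), abs_nonneg (X l ω)]
  have hXl : ∀ ω, |X l ω| ≤ S ω := fun ω => by
    rw [hSdef]; linarith [abs_nonneg (X j ω), abs_nonneg (X k ω), abs_nonneg (X i ω)]
  have hGm : AEMeasurable (fun ω => T (X i ω) * T (X j ω)) P := (hTm (hm i)).mul (hTm (hm j))
  have hHm : AEMeasurable (fun ω => T (X k ω) * T (X l ω)) P := (hTm (hm k)).mul (hTm (hm l))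
  have hNle : ∀ t, 0 ≤ t → t ≤ 4 * C + 1 → ∫ ω, Real.exp (t * absSum X i j k l ω) ∂P ≤ N := by
    intro t ht ht'
    refine (integral_mono (h.integrable_exp_absSum t i j k l)
      (h.integrable_exp_absSum (4 * C + 1) i j k l) fun ω => ?_).trans
      (h.integral_exp_absSum_le (4 * C + 1) i j k l)
    have := hS0 ω
    simp only [Real.exp_le_exp]; gcongr
  have hmain : |cov[fun ω => T (X i ω) * T (X j ω), fun ω => T (X k ω) * T (X l ω); P]| ≤
      2 * C ^ 4 * (N + N ^ 2) * ε := by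
    -- For `ε ≤ 1` the residuals stay below `S`; for `ε > 1` the crude moment bound suffices.
    rcases le_or_gt ε 1 with hε1 | hε1
    · set W : Ω → ℝ := fun ω => X k ω - (a₁ * X i ω + a₂ * X j ω) with hW
      set W' : Ω → ℝ := fun ω => X l ω - (b₁ * X i ω + b₂ * X j ω) with hW'
      have hlin : ∀ (x y : ℝ) (ω : Ω), |x| ≤ ε → |y| ≤ ε →
          |x * X i ω + y * X j ω| ≤ ε * (|X i ω| + |X j ω|) := by
        intro x y ω hx hy
        calc _ ≤ |x| * |X i ω| + |y| * |X j ω| := by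
              rw [← abs_mul, ← abs_mul]; exact abs_add_le _ _
          _ ≤ ε * |X i ω| + ε * |X j ω| := by gcongr
          _ = _ := by ring
      have hlinS : ∀ ω, ε * (|X i ω| + |X j ω|) ≤ ε * S ω := fun ω => by
        gcongr; rw [hSdef]; linarith [abs_nonneg (X k ω), abs_nonneg (X l ω)]
      have hlin1 : ∀ ω, ε * (|X i ω| + |X j ω|) ≤ |X i ω| + |X j ω| := fun ω =>
        mul_le_of_le_one_left (by positivity) hε1
      have hWS : ∀ ω, |W ω| ≤ S ω := fun ω => by
        have h1 := hlin a₁ a₂ ω ha₁' ha₂'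
        have h2 : |W ω| ≤ |X k ω| + |a₁ * X i ω + a₂ * X j ω| := abs_sub _ _
        rw [hSdef]; linarith [hlin1 ω, abs_nonneg (X l ω)]
      have hWS' : ∀ ω, |W' ω| ≤ S ω := fun ω => by
        have h1 := hlin b₁ b₂ ω hb₁' hb₂'
        have h2 : |W' ω| ≤ |X l ω| + |b₁ * X i ω + b₂ * X j ω| := abs_sub _ _
        rw [hSdef]; linarith [hlin1 ω, abs_nonneg (X k ω)]
      have hWm : AEMeasurable W P := (hm k).sub (((hm i).const_mul _).add ((hm j).const_mul _))
      have hWm' : AEMeasurable W' P := (hm l).sub (((hm i).const_mul _).add ((hm j).const_mul _))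
      have hRm : AEMeasurable (fun ω => T (W ω) * T (W' ω)) P := (hTm hWm).mul (hTm hWm')
      have hGL := h.memLp_of_le hGm.aestronglyMeasurable
        (fun ω => hprod _ _ ω (hXi ω) (hXj ω))
      have hHL := h.memLp_of_le hHm.aestronglyMeasurable
        (fun ω => hprod _ _ ω (hXk ω) (hXl ω))
      have hRL := h.memLp_of_le hRm.aestronglyMeasurable
        (fun ω => hprod _ _ ω (hWS ω) (hWS' ω))
      have hind := (h.indepFun_residual hak hal hbk hbl).comp
        (φ := fun u : Fin 2 → ℝ => T (u 0) * T (u 1)) (ψ := fun u : Fin 2 → ℝ => T (u 0) * T (u 1))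
        (by have := hT.continuous.measurable; fun_prop)
        (by have := hT.continuous.measurable; fun_prop)
      have hzero : cov[fun ω => T (X i ω) * T (X j ω), fun ω => T (W ω) * T (W' ω); P] = 0 :=
        IndepFun.covariance_eq_zero hind hGL hRL
      have hsub := covariance_fun_sub_right hGL hHL hRL
      rw [hzero, sub_zero] at hsub
      rw [← hsub]
      have hdiff : ∀ ω, |T (X k ω) * T (X l ω) - T (W ω) * T (W' ω)| ≤
          (2 * C ^ 2 * ε) * Real.exp ((2 * C + 1) * S ω) := by
        intro ω
        have e : T (X k ω) * T (X l ω) - T (W ω) * T (W' ω) =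
            T (X k ω) * (T (X l ω) - T (W' ω)) + T (W' ω) * (T (X k ω) - T (W ω)) := by ring
        have h1 := abs_sub_le_of_exp_bound hT hC (fun t => (hb t).2) (hXk ω) (hWS ω)
        have h2 := abs_sub_le_of_exp_bound hT hC (fun t => (hb t).2) (hXl ω) (hWS' ω)
        have h3 : |X k ω - W ω| ≤ ε * S ω := by
          have : X k ω - W ω = a₁ * X i ω + a₂ * X j ω := by rw [hW]; ring
          rw [this]; exact (hlin a₁ a₂ ω ha₁' ha₂').trans (hlinS ω)
        have h4 : |X l ω - W' ω| ≤ ε * S ω := by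
          have : X l ω - W' ω = b₁ * X i ω + b₂ * X j ω := by rw [hW']; ring
          rw [this]; exact (hlin b₁ b₂ ω hb₁' hb₂').trans (hlinS ω)
        have h5 : S ω ≤ Real.exp (S ω) := by linarith [Real.add_one_le_exp (S ω)]
        have hSω := hS0 ω
        have h6 : |T (X k ω)| ≤ C * Real.exp (C * S ω) := hbT _ ω (hXk ω)
        have h7 : |T (W' ω)| ≤ C * Real.exp (C * S ω) := hbT _ ω (hWS' ω)
        calc _ ≤ |T (X k ω)| * |T (X l ω) - T (W' ω)| + |T (W' ω)| * |T (X k ω) - T (W ω)| := by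
              rw [e, ← abs_mul, ← abs_mul]; exact abs_add_le _ _
          _ ≤ (C * Real.exp (C * S ω)) * (C * Real.exp (C * S ω) * (ε * Real.exp (S ω))) +
              (C * Real.exp (C * S ω)) * (C * Real.exp (C * S ω) * (ε * Real.exp (S ω))) := by
              gcongr
              · exact h2.trans (by gcongr; exact h4.trans (by gcongr))
              · exact h1.trans (by gcongr; exact h3.trans (by gcongr))
          _ = _ := by
              rw [show (2 * C + 1) * S ω = C * S ω + C * S ω + S ω by ring, Real.exp_add, Real.exp_add]
              ring
      have hfin := h.abs_covariance_le hGm.aestronglyMeasurable (hHm.sub hRm).aestronglyMeasurable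
        (fun ω => hprod _ _ ω (hXi ω) (hXj ω)) hdiff (by positivity) (by positivity)
        (hNle (2 * C + (2 * C + 1)) (by positivity) (by linarith))
      refine hfin.trans (le_of_eq (by ring))
    · have hfin := h.abs_covariance_le hGm.aestronglyMeasurable hHm.aestronglyMeasurable
        (fun ω => hprod _ _ ω (hXi ω) (hXj ω)) (fun ω => hprod _ _ ω (hXk ω) (hXl ω))
        (by positivity) (by positivity) (hNle (2 * C + 2 * C) (by positivity) (by linarith))
      refine hfin.trans ?_
      have h0 : 0 ≤ C ^ 4 * (N + N ^ 2) := by positivity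
      nlinarith
  refine hmain.trans ?_
  rw [hε]
  nlinarith

end GaussianSequence

theorem sum_mul_mul_le {n : ℕ} {A B κ : Fin n → Fin n → ℝ}
    (hB : ∀ i j, 0 ≤ B i j) (hκ : ∀ i j, 0 ≤ κ i j) {K L : ℝ} (hK : 0 ≤ K)
    (hAK : ∀ i, ∑ j, A i j ≤ K) (hBK : ∀ i, ∑ j, B i j ≤ K) (hκL : ∀ i, ∑ j, κ i j ≤ L) :
    ∑ i, ∑ j, ∑ k, ∑ l, A i j * B k l * κ i k ≤ n * (K * K * L) := by
  calc _ = ∑ i, (∑ j, A i j) * ∑ k, (∑ l, B k l) * κ i k := by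
        refine Finset.sum_congr rfl fun i _ => ?_
        rw [Finset.sum_mul]
        refine Finset.sum_congr rfl fun j _ => ?_
        rw [Finset.mul_sum]
        refine Finset.sum_congr rfl fun k _ => ?_
        rw [Finset.sum_mul, Finset.mul_sum]
        exact Finset.sum_congr rfl fun l _ => by ring
    _ ≤ ∑ _i : Fin n, K * (K * L) := by
        refine Finset.sum_le_sum fun i _ => ?_
        refine mul_le_mul (hAK i) ?_ ?_ hK
        · calc _ ≤ ∑ k, K * κ i k := Finset.sum_le_sum fun k _ =>
                mul_le_mul_of_nonneg_right (hBK k) (hκ i k)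
            _ ≤ _ := by rw [← Finset.mul_sum]; gcongr; exact hκL i
        · exact Finset.sum_nonneg fun k _ => mul_nonneg (Finset.sum_nonneg fun l _ => hB k l) (hκ i k)
    _ = _ := by rw [Finset.sum_const, Finset.card_univ, Fintype.card_fin, nsmul_eq_mul]; ring

/-- The variance of a quadratic form in a transformed Gaussian sequence with summable covariances
grows at most linearly in the dimension. -/
theorem GaussianSequence.exists_variance_le {Ω : Type*} [MeasurableSpace Ω] {P : Measure Ω}
    [IsProbabilityMeasure P] {X : ℕ → Ω → ℝ} {κ : ℕ → ℕ → ℝ} {v c : ℝ}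
    (h : GaussianSequence P X κ v c) {T : ℝ → ℝ} (hT : ContDiff ℝ 1 T) {C : ℝ}
    (hb : ∀ t, |T t| ≤ C * Real.exp (C * |t|) ∧ |deriv T t| ≤ C * Real.exp (C * |t|))
    {L : ℝ} (hL : ∀ (n : ℕ) (i : Fin n), ∑ j : Fin n, |κ i j| ≤ L) :
    ∃ D : ℝ, 0 < D ∧ ∀ (n : ℕ) (A : Matrix (Fin n) (Fin n) ℝ) (K : ℝ), 0 ≤ K →
      (∀ i, ∑ j, |A i j| ≤ K) → (∀ j, ∑ i, |A i j| ≤ K) →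
      Var[fun ω => ∑ i, ∑ j, A i j * (T (X i ω) * T (X j ω)); P] ≤ n * (D * K ^ 2) := by
  obtain ⟨D, hD, hcov⟩ := h.exists_abs_covariance_mul_le hT hb
  have hL0 : 0 ≤ L := (Finset.sum_nonneg fun j _ => abs_nonneg _).trans (hL 1 0)
  refine ⟨4 * D * L + 1, by positivity, fun n A K hK hrow hcol => ?_⟩
  have hLp := fun i j : ℕ => (h.memLp_mul hT (fun t => (hb t).1) i j).1
  have e : Var[fun ω => ∑ i, ∑ j, A i j * (T (X i ω) * T (X j ω)); P] =
      ∑ i : Fin n, ∑ k : Fin n, ∑ j : Fin n, ∑ l : Fin n, A i j * (A k l *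
        cov[fun ω => T (X i ω) * T (X j ω), fun ω => T (X k ω) * T (X l ω); P]) := by
    have hmem : ∀ i : Fin n, MemLp (fun ω => ∑ j : Fin n, A i j * (T (X i ω) * T (X j ω))) 2 P :=
      fun i => memLp_finsetSum _ fun j _ => (hLp i j).const_mul (A i j)
    rw [variance_fun_sum hmem]
    refine Finset.sum_congr rfl fun i _ => Finset.sum_congr rfl fun k _ => ?_
    rw [covariance_fun_sum_fun_sum (fun j : Fin n => (hLp i j).const_mul _)
      (fun l : Fin n => (hLp k l).const_mul _)]
    refine Finset.sum_congr rfl fun j _ => Finset.sum_congr rfl fun l _ => ?_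
    rw [covariance_const_mul_left, covariance_const_mul_right]
  rw [e]
  set a : Fin n → Fin n → ℝ := fun i j => |A i j| with ha
  set at' : Fin n → Fin n → ℝ := fun i j => |A j i| with hat
  set g : Fin n → Fin n → ℝ := fun i j => |κ i j| with hg
  have ha0 : ∀ i j, 0 ≤ a i j := fun i j => abs_nonneg _
  have hat0 : ∀ i j, 0 ≤ at' i j := fun i j => abs_nonneg _
  have hg0 : ∀ i j, 0 ≤ g i j := fun i j => abs_nonneg _
  have b1 := sum_mul_mul_le (A := a) ha0 hg0 hK hrow hrow (hL n)
  have b2 := sum_mul_mul_le (A := at') ha0 hg0 hK hcol hrow (hL n)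
  have b3 := sum_mul_mul_le (A := a) hat0 hg0 hK hrow hcol (hL n)
  have b4 := sum_mul_mul_le (A := at') hat0 hg0 hK hcol hcol (hL n)
  have c1 : ∑ i, ∑ k, ∑ j, ∑ l, a i j * a k l * g i k = ∑ i, ∑ j, ∑ k, ∑ l, a i j * a k l * g i k :=
    Finset.sum_congr rfl fun i _ => Finset.sum_comm
  have c2 : ∑ i, ∑ k, ∑ j, ∑ l, a i j * a k l * g j k =
      ∑ i, ∑ j, ∑ k, ∑ l, at' i j * a k l * g i k := by
    calc _ = ∑ i, ∑ j, ∑ k, ∑ l, a i j * a k l * g j k :=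
          Finset.sum_congr rfl fun i _ => Finset.sum_comm
      _ = _ := Finset.sum_comm
  have c3 : ∑ i, ∑ k, ∑ j, ∑ l, a i j * a k l * g i l =
      ∑ i, ∑ j, ∑ k, ∑ l, a i j * at' k l * g i k := by
    refine Finset.sum_congr rfl fun i _ => ?_
    rw [Finset.sum_comm]
    exact Finset.sum_congr rfl fun j _ => Finset.sum_comm
  have c4 : ∑ i, ∑ k, ∑ j, ∑ l, a i j * a k l * g j l =
      ∑ i, ∑ j, ∑ k, ∑ l, at' i j * at' k l * g i k := by
    calc _ = ∑ i, ∑ j, ∑ k, ∑ l, a i j * a k l * g j l :=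
          Finset.sum_congr rfl fun i _ => Finset.sum_comm
      _ = ∑ j, ∑ i, ∑ k, ∑ l, a i j * a k l * g j l := Finset.sum_comm
      _ = _ := Finset.sum_congr rfl fun j _ => Finset.sum_congr rfl fun i _ => Finset.sum_comm
  calc _ ≤ ∑ i, ∑ k, ∑ j, ∑ l, D * (a i j * a k l * g i k + a i j * a k l * g j k +
        a i j * a k l * g i l + a i j * a k l * g j l) := by
        refine Finset.sum_le_sum fun i _ => Finset.sum_le_sum fun k _ =>
          Finset.sum_le_sum fun j _ => Finset.sum_le_sum fun l _ => ?_
        calc _ ≤ |A i j * (A k l * cov[fun ω => T (X i ω) * T (X j ω),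
              fun ω => T (X k ω) * T (X l ω); P])| := le_abs_self _
          _ = a i j * (a k l * |cov[fun ω => T (X i ω) * T (X j ω),
              fun ω => T (X k ω) * T (X l ω); P]|) := by rw [abs_mul, abs_mul]
          _ ≤ a i j * (a k l * (D * (g i k + g j k + g i l + g j l))) := by
              have := hcov i j k l
              have := ha0 i j
              have := ha0 k l
              gcongr
          _ = _ := by ring
    _ = D * (∑ i, ∑ k, ∑ j, ∑ l, a i j * a k l * g i k + ∑ i, ∑ k, ∑ j, ∑ l, a i j * a k l * g j k +
        ∑ i, ∑ k, ∑ j, ∑ l, a i j * a k l * g i l + ∑ i, ∑ k, ∑ j, ∑ l, a i j * a k l * g j l) := by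
        simp only [← Finset.mul_sum, Finset.sum_add_distrib]
    _ ≤ D * (n * (K * K * L) + n * (K * K * L) + n * (K * K * L) + n * (K * K * L)) := by
        rw [c1, c2, c3, c4]; gcongr
    _ ≤ n * ((4 * D * L + 1) * K ^ 2) := by
        have : 0 ≤ (n : ℝ) * K ^ 2 := by positivity
        nlinarith

/-! ### Operator norms, approximate inverses and the Kullback–Leibler contrast -/

section MatrixBounds

open scoped Matrix Matrix.Norms.L2Operator

theorem Matrix.mulVec_dotProduct_self_le {n : ℕ} (A : Matrix (Fin n) (Fin n) ℝ) (v : Fin n → ℝ) :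
    (A.mulVec v) ⬝ᵥ (A.mulVec v) ≤ ‖A‖ ^ 2 * (v ⬝ᵥ v) := by
  have h := Matrix.l2_opNorm_mulVec A (WithLp.toLp 2 v)
  have h2 := pow_le_pow_left₀ (norm_nonneg _) h 2
  rw [mul_pow, EuclideanSpace.real_norm_sq_eq, EuclideanSpace.real_norm_sq_eq] at h2
  simpa [dotProduct, sq] using h2

theorem Matrix.l2_opNorm_le_of_sq_le {n : ℕ} (A : Matrix (Fin n) (Fin n) ℝ) {c : ℝ} (hc : 0 ≤ c)
    (h : ∀ v : Fin n → ℝ, (A.mulVec v) ⬝ᵥ (A.mulVec v) ≤ c ^ 2 * (v ⬝ᵥ v)) : ‖A‖ ≤ c := by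
  rw [← Matrix.l2_opNorm_toEuclideanCLM]
  refine ContinuousLinearMap.opNorm_le_bound _ hc fun x => ?_
  refine le_of_sq_le_sq ?_ (by positivity)
  rw [mul_pow, EuclideanSpace.real_norm_sq_eq, EuclideanSpace.real_norm_sq_eq]
  simpa [dotProduct, sq] using h x.ofLp

theorem dotProduct_self_nonneg_real {n : ℕ} (v : Fin n → ℝ) : 0 ≤ v ⬝ᵥ v :=
  Finset.sum_nonneg fun _ _ => mul_self_nonneg _

theorem dotProduct_sq_le {n : ℕ} (v w : Fin n → ℝ) : (v ⬝ᵥ w) ^ 2 ≤ (v ⬝ᵥ v) * (w ⬝ᵥ w) := by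
  simpa [dotProduct, sq] using Finset.sum_mul_sq_le_sq_mul_sq Finset.univ v w

theorem Matrix.abs_quadForm_le {n : ℕ} (A : Matrix (Fin n) (Fin n) ℝ) (v : Fin n → ℝ) :
    |v ⬝ᵥ A.mulVec v| ≤ ‖A‖ * (v ⬝ᵥ v) := by
  refine abs_le_of_sq_le_sq ?_ (mul_nonneg (norm_nonneg _) (dotProduct_self_nonneg_real v))
  calc _ ≤ (v ⬝ᵥ v) * (A.mulVec v ⬝ᵥ A.mulVec v) := dotProduct_sq_le _ _
    _ ≤ (v ⬝ᵥ v) * (‖A‖ ^ 2 * (v ⬝ᵥ v)) :=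
        mul_le_mul_of_nonneg_left (A.mulVec_dotProduct_self_le v) (dotProduct_self_nonneg_real v)
    _ = _ := by ring

/-- The Schur test. -/
theorem Matrix.l2_opNorm_le_of_sum_abs_le {n : ℕ} (A : Matrix (Fin n) (Fin n) ℝ) {K : ℝ} (hK : 0 ≤ K)
    (hrow : ∀ i, ∑ j, |A i j| ≤ K) (hcol : ∀ j, ∑ i, |A i j| ≤ K) : ‖A‖ ≤ K := by
  refine A.l2_opNorm_le_of_sq_le hK fun v => ?_
  have h1 : ∀ i, (A.mulVec v i) ^ 2 ≤ K * ∑ j, |A i j| * v j ^ 2 := by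
    intro i
    calc (A.mulVec v i) ^ 2 ≤ (∑ j, |A i j|) * ∑ j, |A i j| * v j ^ 2 := by
          change (∑ j, A i j * v j) ^ 2 ≤ _
          refine Finset.sum_sq_le_sum_mul_sum_of_sq_le_mul (f := fun j => |A i j|)
            (g := fun j => |A i j| * v j ^ 2) (r := fun j => A i j * v j) _
            (fun j _ => abs_nonneg _) (fun j _ => by positivity) fun j _ => ?_
          rw [← mul_assoc, abs_mul_abs_self]
          exact le_of_eq (by ring)
      _ ≤ _ := by gcongr; exact hrow i
  calc (A.mulVec v) ⬝ᵥ (A.mulVec v) = ∑ i, (A.mulVec v i) ^ 2 := by simp only [dotProduct, sq]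
    _ ≤ ∑ i, K * ∑ j, |A i j| * v j ^ 2 := Finset.sum_le_sum fun i _ => h1 i
    _ = K * ∑ j, (∑ i, |A i j|) * v j ^ 2 := by
        rw [← Finset.mul_sum, Finset.sum_comm]; simp only [Finset.sum_mul]
    _ ≤ K * ∑ j, K * v j ^ 2 := by
        gcongr with j; exact hcol j
    _ = K ^ 2 * (v ⬝ᵥ v) := by simp only [dotProduct, ← Finset.mul_sum, sq]; ring

theorem Matrix.IsSymm.l2_opNorm_le_of_sum_abs_le {n : ℕ} {A : Matrix (Fin n) (Fin n) ℝ}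
    (hA : A.IsSymm) {K : ℝ} (hK : 0 ≤ K) (hrow : ∀ i, ∑ j, |A i j| ≤ K) : ‖A‖ ≤ K := by
  refine A.l2_opNorm_le_of_sum_abs_le hK hrow fun j => ?_
  simpa only [hA.apply] using hrow j

/-- `A` is symmetric and its quadratic form is at least `a` times the squared norm. -/
structure Matrix.Coercive {n : ℕ} (A : Matrix (Fin n) (Fin n) ℝ) (a : ℝ) : Prop where
  symm : A.IsSymm
  pos : 0 < a
  le : ∀ v : Fin n → ℝ, a * (v ⬝ᵥ v) ≤ v ⬝ᵥ A.mulVec v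

namespace Matrix.Coercive

variable {n : ℕ} {A B : Matrix (Fin n) (Fin n) ℝ} {a b : ℝ}

theorem posDef (h : A.Coercive a) : A.PosDef := by
  refine Matrix.PosDef.of_dotProduct_mulVec_pos ?_ fun v hv => ?_
  · rw [Matrix.IsHermitian, Matrix.conjTranspose_eq_transpose_of_trivial]; exact h.symm
  · rw [star_trivial]
    refine lt_of_lt_of_le (mul_pos h.pos ?_) (h.le v)
    exact lt_of_le_of_ne (dotProduct_self_nonneg_real v) (fun e => hv (dotProduct_self_eq_zero.1 e.symm))

theorem isUnit_det (h : A.Coercive a) : IsUnit A.det := h.posDef.det_pos.ne'.isUnit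

theorem norm_inv_le (h : A.Coercive a) : ‖A⁻¹‖ ≤ a⁻¹ := by
  have ha := h.pos
  refine Matrix.l2_opNorm_le_of_sq_le _ (by positivity) fun v => ?_
  set w := A⁻¹.mulVec v with hw
  have hv : v = A.mulVec w := by
    rw [hw, Matrix.mulVec_mulVec, Matrix.mul_nonsing_inv _ h.isUnit_det, Matrix.one_mulVec]
  have h1 := h.le w
  rw [← hv] at h1
  have h2 := dotProduct_sq_le w v
  have hw0 := dotProduct_self_nonneg_real w
  have hv0 := dotProduct_self_nonneg_real v
  rw [inv_pow, inv_mul_eq_div, le_div_iff₀ (by positivity)]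
  rcases hw0.eq_or_lt with h0 | h0
  · rw [← h0, zero_mul]; exact hv0
  · have h3 : (a * (w ⬝ᵥ w)) ^ 2 ≤ (w ⬝ᵥ w) * (v ⬝ᵥ v) :=
      (pow_le_pow_left₀ (by positivity) h1 2).trans h2
    have h4 : (w ⬝ᵥ w) * (w ⬝ᵥ w * a ^ 2) ≤ (w ⬝ᵥ w) * (v ⬝ᵥ v) := by nlinarith
    exact le_of_mul_le_mul_left h4 h0

theorem norm_inv_sub_inv_le (hA : A.Coercive a) (hB : B.Coercive a) :
    ‖A⁻¹ - B⁻¹‖ ≤ a⁻¹ * a⁻¹ * ‖A - B‖ := by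
  have ha := hA.pos
  have e : A⁻¹ - B⁻¹ = A⁻¹ * (B - A) * B⁻¹ := by
    rw [Matrix.mul_sub, Matrix.sub_mul, Matrix.nonsing_inv_mul _ hA.isUnit_det, Matrix.one_mul,
      Matrix.mul_assoc, Matrix.mul_nonsing_inv _ hB.isUnit_det, Matrix.mul_one]
  calc ‖A⁻¹ - B⁻¹‖ ≤ ‖A⁻¹‖ * ‖B - A‖ * ‖B⁻¹‖ := by
        rw [e]
        exact (Matrix.l2_opNorm_mul _ _).trans
          (mul_le_mul_of_nonneg_right (Matrix.l2_opNorm_mul _ _) (norm_nonneg _))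
    _ ≤ a⁻¹ * ‖B - A‖ * a⁻¹ := by
        gcongr
        · exact hA.norm_inv_le
        · exact hB.norm_inv_le
    _ = _ := by rw [norm_sub_rev]; ring

/-- A gradient step with a suitable step size contracts. -/
theorem norm_one_sub_smul_le (h : A.Coercive a) (hb : ‖A‖ ≤ b) (hab : a ≤ b) :
    ‖1 - (a / b ^ 2) • A‖ ≤ Real.sqrt (1 - a ^ 2 / b ^ 2) := by
  have ha := h.pos
  have hbpos : 0 < b := ha.trans_le hab
  refine Matrix.l2_opNorm_le_of_sq_le _ (Real.sqrt_nonneg _) fun v => ?_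
  have h0 : 0 ≤ 1 - a ^ 2 / b ^ 2 := by
    rw [sub_nonneg, div_le_one (by positivity)]; gcongr
  rw [Real.sq_sqrt h0]
  set t := a / b ^ 2 with ht
  have h1 := h.le v
  have h2 : (A.mulVec v) ⬝ᵥ (A.mulVec v) ≤ b ^ 2 * (v ⬝ᵥ v) :=
    (A.mulVec_dotProduct_self_le v).trans (by
      have := dotProduct_self_nonneg_real v
      gcongr)
  have e : ((1 - t • A).mulVec v) ⬝ᵥ ((1 - t • A).mulVec v) =
      v ⬝ᵥ v - 2 * t * (v ⬝ᵥ A.mulVec v) + t ^ 2 * ((A.mulVec v) ⬝ᵥ (A.mulVec v)) := by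
    rw [Matrix.sub_mulVec, Matrix.one_mulVec, Matrix.smul_mulVec, sub_dotProduct, dotProduct_sub,
      dotProduct_sub, dotProduct_smul, smul_dotProduct, smul_dotProduct, dotProduct_smul,
      dotProduct_comm (A.mulVec v) v]
    simp only [smul_eq_mul]; ring
  rw [e]
  have ht0 : 0 < t := by positivity
  have e2 : (1 - a ^ 2 / b ^ 2) * (v ⬝ᵥ v) =
      v ⬝ᵥ v - 2 * t * (a * (v ⬝ᵥ v)) + t ^ 2 * (b ^ 2 * (v ⬝ᵥ v)) := by
    rw [ht]; field_simp; ring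
  rw [e2]
  gcongr

end Matrix.Coercive

theorem Matrix.sum_abs_mul_le {n : ℕ} {A B : Matrix (Fin n) (Fin n) ℝ} {K L : ℝ}
    (hL : 0 ≤ L) (hA : ∀ i, ∑ j, |A i j| ≤ K) (hB : ∀ i, ∑ j, |B i j| ≤ L) (i : Fin n) :
    ∑ j, |(A * B) i j| ≤ K * L := by
  calc ∑ j, |(A * B) i j| ≤ ∑ j, ∑ k, |A i k| * |B k j| := by
        refine Finset.sum_le_sum fun j _ => ?_
        rw [Matrix.mul_apply]
        refine (Finset.abs_sum_le_sum_abs _ _).trans (le_of_eq ?_)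
        simp only [abs_mul]
    _ = ∑ k, |A i k| * ∑ j, |B k j| := by
        rw [Finset.sum_comm]; simp only [Finset.mul_sum]
    _ ≤ ∑ k, |A i k| * L := by gcongr with k; exact hB k
    _ ≤ K * L := by rw [← Finset.sum_mul]; gcongr; exact hA i

theorem Matrix.sum_abs_one {n : ℕ} (i : Fin n) : ∑ j, |(1 : Matrix (Fin n) (Fin n) ℝ) i j| = 1 := by
  rw [Finset.sum_eq_single i] <;> simp +contextual [eq_comm]

theorem Matrix.sum_abs_pow_le {n : ℕ} {A : Matrix (Fin n) (Fin n) ℝ} {K : ℝ} (hK : 0 ≤ K)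
    (hA : ∀ i, ∑ j, |A i j| ≤ K) (m : ℕ) (i : Fin n) : ∑ j, |(A ^ m) i j| ≤ K ^ m := by
  induction m generalizing i with
  | zero => simp [Matrix.sum_abs_one]
  | succ m ih => rw [pow_succ, pow_succ]; exact Matrix.sum_abs_mul_le hK ih hA i

/-- Inverses of well-conditioned symmetric matrices are approximated in operator norm by symmetric
matrices with bounded absolute row sums, uniformly in the dimension: truncate the Neumann series. -/
theorem exists_approx_inverse {a b : ℝ} (ha : 0 < a) (hab : a ≤ b) {η : ℝ} (hη : 0 < η) :
    ∃ K : ℝ, 0 ≤ K ∧ ∀ (n : ℕ) (R : Matrix (Fin n) (Fin n) ℝ), R.Coercive a →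
      (∀ i, ∑ j, |R i j| ≤ b) →
      ∃ A : Matrix (Fin n) (Fin n) ℝ, A.IsSymm ∧ (∀ i, ∑ j, |A i j| ≤ K) ∧ ‖R⁻¹ - A‖ ≤ η := by
  have hb : 0 < b := ha.trans_le hab
  -- The Neumann series of `R` is the one of `t R = 1 - S`, where `‖S‖ ≤ ρ < 1`.
  set t := a / b ^ 2 with ht
  have ht0 : 0 < t := by positivity
  set ρ := Real.sqrt (1 - a ^ 2 / b ^ 2) with hρ
  have hρ0 : 0 ≤ ρ := Real.sqrt_nonneg _
  have hρ1 : ρ < 1 := by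
    rw [hρ, Real.sqrt_lt' one_pos, one_pow]
    have : 0 < a ^ 2 / b ^ 2 := by positivity
    linarith
  have hlim : Tendsto (fun N : ℕ => a⁻¹ * ρ ^ N) atTop (𝓝 (a⁻¹ * 0)) :=
    (tendsto_pow_atTop_nhds_zero_of_lt_one hρ0 hρ1).const_mul _
  rw [mul_zero] at hlim
  obtain ⟨N, hN, hNpos⟩ := ((hlim.eventually_le_const hη).and (eventually_gt_atTop 0)).exists
  refine ⟨t * ∑ m ∈ Finset.range N, (1 + t * b) ^ m, by positivity, fun n R hR hrow => ?_⟩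
  set S : Matrix (Fin n) (Fin n) ℝ := 1 - t • R with hS
  have hSsymm : S.IsSymm := by
    rw [hS]; exact (Matrix.isSymm_one).sub (hR.symm.smul t)
  have hSrow : ∀ i, ∑ j, |S i j| ≤ 1 + t * b := by
    intro i
    calc ∑ j, |S i j| ≤ ∑ j, (|(1 : Matrix (Fin n) (Fin n) ℝ) i j| + t * |R i j|) := by
          refine Finset.sum_le_sum fun j _ => ?_
          rw [hS, Matrix.sub_apply, Matrix.smul_apply, smul_eq_mul]
          refine (abs_sub _ _).trans (le_of_eq ?_)
          rw [abs_mul, abs_of_pos ht0]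
      _ ≤ 1 + t * b := by
          rw [Finset.sum_add_distrib, Matrix.sum_abs_one, ← Finset.mul_sum]
          gcongr; exact hrow i
  have hRnorm : ‖R‖ ≤ b := hR.symm.l2_opNorm_le_of_sum_abs_le hb.le hrow
  have hSnorm : ‖S‖ ≤ ρ := hR.norm_one_sub_smul_le hRnorm hab
  refine ⟨t • ∑ m ∈ Finset.range N, S ^ m, ?_, fun i => ?_, ?_⟩
  · refine Matrix.IsSymm.smul ?_ t
    rw [Matrix.IsSymm, Matrix.transpose_sum]
    exact Finset.sum_congr rfl fun m _ => hSsymm.pow m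
  · calc ∑ j, |(t • ∑ m ∈ Finset.range N, S ^ m) i j|
        ≤ ∑ j, t * ∑ m ∈ Finset.range N, |(S ^ m) i j| := by
          refine Finset.sum_le_sum fun j _ => ?_
          rw [Matrix.smul_apply, smul_eq_mul, abs_mul, abs_of_pos ht0, Matrix.sum_apply]
          gcongr
          exact Finset.abs_sum_le_sum_abs _ _
      _ = t * ∑ m ∈ Finset.range N, ∑ j, |(S ^ m) i j| := by
          rw [← Finset.mul_sum, Finset.sum_comm]
      _ ≤ _ := by
          gcongr with m
          exact Matrix.sum_abs_pow_le (by positivity) hSrow m i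
  · have hgeom : R * (t • ∑ m ∈ Finset.range N, S ^ m) = 1 - S ^ N := by
      rw [← mul_neg_geom_sum S N, hS, sub_sub_cancel, Matrix.mul_smul, Matrix.smul_mul]
    have e : R⁻¹ - t • ∑ m ∈ Finset.range N, S ^ m = R⁻¹ * S ^ N := by
      have h1 : R⁻¹ * (R * (t • ∑ m ∈ Finset.range N, S ^ m)) = t • ∑ m ∈ Finset.range N, S ^ m := by
        rw [← Matrix.mul_assoc, Matrix.nonsing_inv_mul _ hR.isUnit_det, Matrix.one_mul]
      rw [← h1, hgeom, Matrix.mul_sub, Matrix.mul_one, sub_sub_cancel]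
    rw [e]
    calc ‖R⁻¹ * S ^ N‖ ≤ ‖R⁻¹‖ * ‖S ^ N‖ := Matrix.l2_opNorm_mul _ _
      _ ≤ a⁻¹ * ρ ^ N := by
          gcongr
          · exact hR.norm_inv_le
          · exact (norm_pow_le' S hNpos).trans (by gcongr)
      _ ≤ η := hN

theorem Matrix.sum_sq_mul_le {n : ℕ} (A B : Matrix (Fin n) (Fin n) ℝ) :
    ∑ i, ∑ j, (A * B) i j ^ 2 ≤ ‖A‖ ^ 2 * ∑ i, ∑ j, B i j ^ 2 := by
  rw [Finset.sum_comm, Finset.sum_comm (f := fun i j => B i j ^ 2), Finset.mul_sum]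
  refine Finset.sum_le_sum fun j _ => ?_
  have h := A.mulVec_dotProduct_self_le (fun k => B k j)
  simpa [dotProduct, sq, Matrix.mulVec, Matrix.mul_apply] using h

theorem Matrix.sum_sq_mul_le' {n : ℕ} (A B : Matrix (Fin n) (Fin n) ℝ) :
    ∑ i, ∑ j, (A * B) i j ^ 2 ≤ ‖B‖ ^ 2 * ∑ i, ∑ j, A i j ^ 2 := by
  have h := Matrix.sum_sq_mul_le Bᵀ Aᵀ
  rw [← Matrix.transpose_mul, ← Matrix.conjTranspose_eq_transpose_of_trivial B,
    Matrix.l2_opNorm_conjTranspose] at h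
  simp only [Matrix.transpose_apply] at h
  rwa [Finset.sum_comm, Finset.sum_comm (f := fun i j => A j i ^ 2)] at h

/-- Simultaneous diagonalization of two positive definite matrices by congruence. -/
theorem exists_simultaneous_diagonalization {n : ℕ} {R R₀ : Matrix (Fin n) (Fin n) ℝ}
    (hR : R.PosDef) (hR₀ : R₀.PosDef) :
    ∃ (B : Matrix (Fin n) (Fin n) ℝ) (lam : Fin n → ℝ), IsUnit B.det ∧ (∀ i, 0 < lam i) ∧
      R = Bᴴ * B ∧ R₀ = Bᴴ * Matrix.diagonal lam * B := by
  obtain ⟨Q, hQ⟩ : ∃ Q : Matrix (Fin n) (Fin n) ℝ, R = Qᴴ * Q := by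
    open scoped MatrixOrder in
    exact CStarAlgebra.nonneg_iff_eq_star_mul_self.mp hR.posSemidef.nonneg
  have hQdet : IsUnit Q.det := by
    have h := hR.det_pos.ne'
    rw [hQ, Matrix.det_mul] at h
    exact (right_ne_zero_of_mul h).isUnit
  have hinj : Function.Injective Q⁻¹.mulVec :=
    Matrix.mulVec_injective_of_isUnit ((Matrix.isUnit_iff_isUnit_det _).2
      (Matrix.isUnit_nonsing_inv_det _ hQdet))
  have hS : (Q⁻¹ᴴ * R₀ * Q⁻¹).PosDef := hR₀.conjTranspose_mul_mul_same hinj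
  set S := Q⁻¹ᴴ * R₀ * Q⁻¹ with hSdef
  set U : Matrix (Fin n) (Fin n) ℝ := (hS.isHermitian.eigenvectorUnitary : Matrix (Fin n) (Fin n) ℝ)
    with hU
  have hUU : U * Uᴴ = 1 := Unitary.coe_mul_star_self hS.isHermitian.eigenvectorUnitary
  have hspec : S = U * Matrix.diagonal hS.isHermitian.eigenvalues * Uᴴ := by
    have h := hS.isHermitian.spectral_theorem
    rw [Unitary.conjStarAlgAut_apply] at h
    exact h
  refine ⟨Uᴴ * Q, hS.isHermitian.eigenvalues, ?_, hS.eigenvalues_pos, ?_, ?_⟩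
  · rw [Matrix.det_mul]
    refine IsUnit.mul ?_ hQdet
    have h := congrArg Matrix.det hUU
    rw [Matrix.det_mul, Matrix.det_one] at h
    exact IsUnit.of_mul_eq_one_right _ h
  · rw [Matrix.conjTranspose_mul, Matrix.conjTranspose_conjTranspose, Matrix.mul_assoc,
      ← Matrix.mul_assoc U, hUU, Matrix.one_mul, hQ]
  · have h1 : (Uᴴ * Q)ᴴ * Matrix.diagonal hS.isHermitian.eigenvalues * (Uᴴ * Q) = Qᴴ * S * Q := by
      conv_rhs => rw [hspec]
      rw [Matrix.conjTranspose_mul, Matrix.conjTranspose_conjTranspose]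
      simp only [Matrix.mul_assoc]
    have h2 : Qᴴ * Q⁻¹ᴴ = 1 := by
      rw [← Matrix.conjTranspose_mul, Matrix.nonsing_inv_mul _ hQdet, Matrix.conjTranspose_one]
    rw [h1, hSdef, Matrix.mul_assoc, Matrix.mul_assoc (Q⁻¹ᴴ * R₀), Matrix.nonsing_inv_mul _ hQdet,
      Matrix.mul_one, ← Matrix.mul_assoc, h2, Matrix.one_mul]

/-- Apply `log y ≤ y - 1` to `y = √x`, which gives `x - 1 - log x ≥ (√x - 1) ^ 2`. -/
theorem sub_one_sub_log_ge {x M : ℝ} (hx : 0 < x) (hxM : x ≤ M) :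
    (x - 1) ^ 2 / (Real.sqrt M + 1) ^ 2 ≤ x - 1 - Real.log x := by
  have hs : 0 < Real.sqrt x := Real.sqrt_pos.2 hx
  have hlog : Real.log x ≤ 2 * (Real.sqrt x - 1) := by
    have h := Real.log_le_sub_one_of_pos hs
    rw [Real.log_sqrt hx.le] at h
    linarith
  have hsq := Real.sq_sqrt hx.le
  have hle : Real.sqrt x ≤ Real.sqrt M := Real.sqrt_le_sqrt hxM
  set y := Real.sqrt x
  rw [div_le_iff₀ (by positivity), ← hsq]
  rw [← hsq] at hlog
  calc (y ^ 2 - 1) ^ 2 = (y - 1) ^ 2 * (y + 1) ^ 2 := by ring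
    _ ≤ (y - 1) ^ 2 * (Real.sqrt M + 1) ^ 2 := by gcongr
    _ ≤ _ := by gcongr; linarith

/-- The Gaussian Kullback–Leibler contrast between well-conditioned covariance matrices dominates
their squared Frobenius distance, uniformly in the dimension. -/
theorem exists_kullback_ge {a b : ℝ} (ha : 0 < a) (hb : 0 < b) :
    ∃ c : ℝ, 0 < c ∧ ∀ (n : ℕ) (R R₀ : Matrix (Fin n) (Fin n) ℝ), R.Coercive a → R₀.Coercive a →
      ‖R‖ ≤ b → ‖R₀‖ ≤ b →
      c * ∑ i, ∑ j, (R i j - R₀ i j) ^ 2 ≤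
        Real.log R.det - Real.log R₀.det + (R⁻¹ * R₀).trace - n := by
  refine ⟨1 / (b ^ 2 * (Real.sqrt (b / a) + 1) ^ 2), by positivity, fun n R R₀ hR hR₀ hRb hR₀b => ?_⟩
  obtain ⟨B, lam, hB, hlam, e, e₀⟩ := exists_simultaneous_diagonalization hR.posDef hR₀.posDef
  have hBnorm : ‖B‖ ^ 2 ≤ b := by
    rw [sq, ← Matrix.l2_opNorm_conjTranspose_mul_self, ← e]; exact hRb
  have hRinv : R⁻¹ = B⁻¹ * B⁻¹ᴴ := by
    rw [e, Matrix.mul_inv_rev, Matrix.conjTranspose_nonsing_inv]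
  have hBinv : ‖B⁻¹‖ ^ 2 ≤ a⁻¹ := by
    rw [sq, ← Matrix.l2_opNorm_conjTranspose B⁻¹, ← Matrix.l2_opNorm_conjTranspose_mul_self,
      Matrix.conjTranspose_conjTranspose, ← hRinv]
    exact hR.norm_inv_le
  have hBB : Bᴴ⁻¹ * Bᴴ = 1 :=
    Matrix.nonsing_inv_mul _ (by rw [Matrix.det_conjTranspose]; simpa using hB)
  have hdiag : Matrix.diagonal lam = B⁻¹ᴴ * R₀ * B⁻¹ := by
    rw [e₀, Matrix.conjTranspose_nonsing_inv, ← Matrix.mul_assoc, ← Matrix.mul_assoc, hBB, Matrix.one_mul,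
      Matrix.mul_assoc, Matrix.mul_nonsing_inv _ hB, Matrix.mul_one]
  have hlamM : ∀ i, lam i ≤ b / a := by
    intro i
    calc lam i ≤ ‖lam‖ := (le_abs_self _).trans (norm_le_pi_norm lam i)
      _ = ‖Matrix.diagonal lam‖ := (Matrix.l2_opNorm_diagonal lam).symm
      _ ≤ ‖B⁻¹ᴴ‖ * ‖R₀‖ * ‖B⁻¹‖ := by
          rw [hdiag]
          exact (Matrix.l2_opNorm_mul _ _).trans
            (mul_le_mul_of_nonneg_right (Matrix.l2_opNorm_mul _ _) (norm_nonneg _))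
      _ = ‖R₀‖ * ‖B⁻¹‖ ^ 2 := by rw [Matrix.l2_opNorm_conjTranspose]; ring
      _ ≤ b * a⁻¹ := by gcongr
      _ = b / a := (div_eq_mul_inv _ _).symm
  have htrace : (R⁻¹ * R₀).trace = ∑ i, lam i := by
    rw [hRinv, e₀, Matrix.conjTranspose_nonsing_inv, Matrix.mul_assoc, Matrix.mul_assoc Bᴴ,
      ← Matrix.mul_assoc Bᴴ⁻¹, hBB, Matrix.one_mul, ← Matrix.mul_assoc, Matrix.trace_mul_comm,
      ← Matrix.mul_assoc, Matrix.mul_nonsing_inv _ hB, Matrix.one_mul, Matrix.trace_diagonal]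
  have hlog : Real.log R₀.det = Real.log R.det + ∑ i, Real.log (lam i) := by
    rw [← Real.log_prod (fun i _ => (hlam i).ne'),
      ← Real.log_mul hR.posDef.det_pos.ne' (Finset.prod_pos fun i _ => hlam i).ne']
    congr 1
    rw [e, e₀, Matrix.det_mul, Matrix.det_mul, Matrix.det_mul, Matrix.det_diagonal]
    ring
  have hfrob : ∑ i, ∑ j, (R i j - R₀ i j) ^ 2 ≤ b ^ 2 * ∑ i, (lam i - 1) ^ 2 := by
    have e1 : R - R₀ = Bᴴ * (1 - Matrix.diagonal lam) * B := by
      rw [Matrix.mul_sub, Matrix.sub_mul, Matrix.mul_one, ← e, ← e₀]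
    have h1 := Matrix.sum_sq_mul_le' (Bᴴ * (1 - Matrix.diagonal lam)) B
    have h2 := Matrix.sum_sq_mul_le Bᴴ (1 - Matrix.diagonal lam)
    rw [Matrix.l2_opNorm_conjTranspose] at h2
    rw [← e1] at h1
    have h3 : ∑ i, ∑ j, (1 - Matrix.diagonal lam) i j ^ 2 = ∑ i, (lam i - 1) ^ 2 := by
      refine Finset.sum_congr rfl fun i _ => ?_
      rw [Finset.sum_eq_single i]
      · simp; ring
      · intro j _ hj; simp [hj.symm]
      · simp
    rw [h3] at h2
    have h4 : 0 ≤ ∑ i, (lam i - 1) ^ 2 := Finset.sum_nonneg fun i _ => sq_nonneg _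
    calc _ ≤ ‖B‖ ^ 2 * (‖B‖ ^ 2 * ∑ i, (lam i - 1) ^ 2) := h1.trans (by gcongr)
      _ ≤ b * (b * ∑ i, (lam i - 1) ^ 2) := by gcongr
      _ = _ := by ring
  have hsum : Real.log R.det - Real.log R₀.det + (R⁻¹ * R₀).trace - n =
      ∑ i, (lam i - 1 - Real.log (lam i)) := by
    rw [htrace, hlog]
    simp only [Finset.sum_sub_distrib, Finset.sum_const, Finset.card_univ, Fintype.card_fin,
      nsmul_eq_mul, mul_one]
    ring
  rw [hsum]
  calc _ ≤ 1 / (b ^ 2 * (Real.sqrt (b / a) + 1) ^ 2) * (b ^ 2 * ∑ i, (lam i - 1) ^ 2) := by gcongr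
    _ = ∑ i, (lam i - 1) ^ 2 / (Real.sqrt (b / a) + 1) ^ 2 := by
        rw [← Finset.sum_div]; field_simp
    _ ≤ _ := Finset.sum_le_sum fun i _ => sub_one_sub_log_ge (hlam i) (hlamM i)

end MatrixBounds

/-! ### Covariance matrices of the model -/

section CovarianceModel

open scoped Matrix Matrix.Norms.L2Operator

theorem covMatrix_apply {d : ℕ} (k : Space d → ℝ) (s : ℕ → Space d) (n : ℕ) (i j : Fin n) :
    covMatrix k s n i j = k (s i - s j) := rfl

theorem IsStationaryCovariance.isSymm_covMatrix {d : ℕ} {k : Space d → ℝ}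
    (hk : IsStationaryCovariance k) (s : ℕ → Space d) (n : ℕ) : (covMatrix k s n).IsSymm := by
  have h := (hk n s).isHermitian
  rwa [Matrix.IsHermitian, Matrix.conjTranspose_eq_transpose_of_trivial] at h

theorem quadForm_ge_of_eigenvalues {n : ℕ} {M : Matrix (Fin n) (Fin n) ℝ} (hM : M.IsSymm) {c : ℝ}
    (h : ∀ lam : ℝ, Module.End.HasEigenvalue (Matrix.toLin' M) lam → c ≤ lam) (v : Fin n → ℝ) :
    c * (v ⬝ᵥ v) ≤ v ⬝ᵥ M.mulVec v := by
  have hMh : M.IsHermitian := by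
    rwa [Matrix.IsHermitian, Matrix.conjTranspose_eq_transpose_of_trivial]
  have hsymm : (M - algebraMap ℝ _ c).IsHermitian := by
    refine hMh.sub ?_
    rw [Matrix.algebraMap_eq_diagonal]
    exact Matrix.isHermitian_diagonal _
  have hpsd : (M - algebraMap ℝ _ c).PosSemidef := by
    rw [Matrix.posSemidef_iff_isHermitian_and_spectrum_nonneg]
    refine ⟨hsymm, fun μ hμ => ?_⟩
    have h1 : μ + c ∈ spectrum ℝ M := by
      rw [spectrum.add_mem_iff, ← sub_eq_neg_add]; exact hμ
    have h2 := h (μ + c) (Module.End.hasEigenvalue_iff_mem_spectrum.2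
      (by rwa [Matrix.spectrum_toLin']))
    simpa using h2
  have h3 := hpsd.dotProduct_mulVec_nonneg v
  rw [star_trivial, Matrix.sub_mulVec, dotProduct_sub, Algebra.algebraMap_eq_smul_one,
    Matrix.smul_mulVec, Matrix.one_mulVec, dotProduct_smul, smul_eq_mul] at h3
  linarith

/-- The eigenvalue bound, applied to test vectors supported on one or two locations, keeps the
variance and the correlations of the process away from degeneracy. -/
theorem TransformedGaussianSetting.exists_gaussianSequence {d : ℕ} {Ω : Type*} [MeasurableSpace Ω]
    {P : Measure Ω} {Z : Space d → Ω → ℝ} {kZ : Space d → ℝ} {T : ℝ → ℝ} {s : ℕ → Space d}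
    (h : TransformedGaussianSetting P Z kZ T s) :
    ∃ c, GaussianSequence P (fun i => Z (s i)) (fun i j => kZ (s i - s j)) (kZ 0) c := by
  obtain ⟨c, hc, hlam⟩ := h.covarianceCond.asympPos s h.wellSeparated
  have hsymm : ∀ i j, kZ (s i - s j) = kZ (s j - s i) := fun i j => by
    rw [← h.covariance, ← h.covariance, covariance_comm]
  have hquad : ∀ (n : ℕ) (v : Fin n → ℝ), c * (v ⬝ᵥ v) ≤ v ⬝ᵥ (covMatrix kZ s n).mulVec v :=
    fun n v => quadForm_ge_of_eigenvalues
      (Matrix.IsSymm.ext fun i j => by simp only [covMatrix_apply]; exact hsymm _ _) (hlam n) v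
  refine ⟨c, ?_⟩
  refine
    { gaussian := h.gaussian.comp_right s
      mean := fun i => h.zeroMean (s i)
      cov := fun i j => h.covariance (s i) (s j)
      diag := fun i => by rw [sub_self]
      pos := hc
      le_diag := ?_
      gap := fun i j hij => ?_ }
  · have := hquad 1 (Pi.single 0 1)
    simpa [covMatrix_apply] using this
  · have key : ∀ e : ℝ, e ^ 2 = 1 → 2 * c ≤ 2 * kZ 0 + 2 * (e * kZ (s i - s j)) := by
      intro e he
      set i' : Fin (max i j + 1) := ⟨i, by omega⟩ with hi'
      set j' : Fin (max i j + 1) := ⟨j, by omega⟩ with hj'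
      have hne : i' ≠ j' := fun h => hij (congrArg Fin.val h)
      have h1 := hquad (max i j + 1) (Pi.single i' 1 + e • Pi.single j' 1)
      simp only [Matrix.mulVec_add, Matrix.mulVec_smul, Matrix.mulVec_single_one, add_dotProduct,
        smul_dotProduct, single_one_dotProduct, Pi.add_apply, Pi.smul_apply, Matrix.col_apply,
        covMatrix_apply, smul_eq_mul, Pi.single_eq_same, Pi.single_eq_of_ne hne,
        Pi.single_eq_of_ne hne.symm, sub_self, hsymm (j' : ℕ) (i' : ℕ)] at h1
      have e3 : (i' : ℕ) = i := rfl
      have e4 : (j' : ℕ) = j := rfl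
      rw [e3, e4] at h1
      have h2 : c * (1 + e ^ 2) ≤ kZ 0 * (1 + e ^ 2) + 2 * (e * kZ (s i - s j)) := by linarith
      rw [he] at h2
      linarith
    have h1 := key 1 (by norm_num)
    have h2 := key (-1) (by norm_num)
    have h3 : |kZ (s i - s j)| ≤ kZ 0 - c := abs_le.2 ⟨by linarith, by linarith⟩
    linarith

theorem sum_fin_eq {d : ℕ} (s : ℕ → Space d) (f : Space d → ℝ) (x : Space d) (n : ℕ) :
    ∑ j : Fin n, f (x - s j) = ∑ j ∈ Finset.range n, f (x - s j) :=
  Fin.sum_univ_eq_sum_range (fun j => f (x - s j)) n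

theorem WellSeparated.exists_sum_abs_le {d : ℕ} {s : ℕ → Space d} (hs : WellSeparated s) {C c : ℝ}
    (hc : 0 < c) :
    ∃ b : ℝ, 0 < b ∧ ∀ k : Space d → ℝ, (∀ x, |k x| ≤ C * Real.exp (-c * ‖x‖)) →
      ∀ (n : ℕ) (i : Fin n), ∑ j : Fin n, |k (s i - s j)| ≤ b := by
  obtain ⟨K, hK, h⟩ := hs.exists_sum_exp_le hc
  refine ⟨|C| * K + 1, by positivity, fun k hk n i => ?_⟩
  rw [sum_fin_eq s (fun x => |k x|)]
  calc _ ≤ ∑ j ∈ Finset.range n, |C| * Real.exp (-c * ‖s i - s j‖) :=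
        Finset.sum_le_sum fun j _ => (hk _).trans (by gcongr; exact le_abs_self C)
    _ ≤ |C| * K := by rw [← Finset.mul_sum]; gcongr; exact h _ _
    _ ≤ _ := by linarith

theorem norm_fderiv_le_of_partialDeriv {p : ℕ} {g : Param p → ℝ} {θ : Param p} {M : ℝ}
    (h : ∀ i : Fin 1 → Fin p, |partialDeriv g 1 i θ| ≤ M) : ‖fderiv ℝ g θ‖ ≤ p * M := by
  have h1 : ∀ i : Fin p, ‖fderiv ℝ g θ (EuclideanSpace.single i 1)‖ ≤ M := by
    intro i
    have := h (fun _ => i)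
    simpa [partialDeriv, iteratedFDeriv_one_apply] using this
  have hM : 0 ≤ (p : ℝ) * M := by
    rcases Nat.eq_zero_or_pos p with rfl | hp
    · simp
    · exact mul_nonneg (Nat.cast_nonneg _) ((norm_nonneg _).trans (h1 ⟨0, hp⟩))
  refine ContinuousLinearMap.opNorm_le_bound _ hM fun x => ?_
  have hx : x = ∑ i, x i • (EuclideanSpace.single i (1 : ℝ) : Param p) := by
    have := (EuclideanSpace.basisFun (Fin p) ℝ).sum_repr x
    simpa using this.symm
  calc ‖fderiv ℝ g θ x‖ = ‖∑ i, x i • fderiv ℝ g θ (EuclideanSpace.single i 1)‖ := by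
        conv_lhs => rw [hx]
        rw [map_sum]; simp only [map_smul]
    _ ≤ ∑ i : Fin p, ‖x‖ * M := by
        refine norm_sum_le_of_le _ fun i _ => ?_
        rw [norm_smul]
        exact mul_le_mul (PiLp.norm_apply_le x i) (h1 i) (norm_nonneg _) (norm_nonneg _)
    _ = p * M * ‖x‖ := by
        rw [Finset.sum_const, Finset.card_univ, Fintype.card_fin, nsmul_eq_mul]; ring

/-- The first-order derivative bound makes the covariance matrices continuous in the parameter, in
the maximal absolute row sum and uniformly in the dimension. -/
theorem SmoothModel.exists_sum_abs_sub_le {d p : ℕ} {Θ : Set (Param p)} {k : Param p → Space d → ℝ}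
    (h : SmoothModel Θ k) {s : ℕ → Space d} (hs : WellSeparated s) {θ : Param p} (hθ : θ ∈ Θ) {ε : ℝ}
    (hε : 0 < ε) :
    ∃ r : ℝ, 0 < r ∧ ∀ θ' ∈ Metric.ball θ r, ∀ (n : ℕ) (i : Fin n),
      ∑ j : Fin n, |k θ' (s i - s j) - k θ (s i - s j)| ≤ ε := by
  obtain ⟨U, hU, hΘU, hC3, C, c, hc, hb⟩ := h.smooth
  obtain ⟨K, hK, hsum⟩ := hs.exists_sum_one_div_le hc
  obtain ⟨r₀, hr₀, hball⟩ := Metric.isOpen_iff.1 hU θ (hΘU hθ)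
  have hlip : ∀ θ' ∈ Metric.ball θ r₀, ∀ x : Space d,
      |k θ' x - k θ x| ≤ p * |C| * ‖θ' - θ‖ * (1 / (1 + ‖x‖ ^ ((d : ℝ) + c))) := by
    intro θ' hθ' x
    have hD : 0 < 1 + ‖x‖ ^ ((d : ℝ) + c) := by positivity
    have := (convex_ball θ r₀).norm_image_sub_le_of_norm_fderiv_le (𝕜 := ℝ) (f := fun η => k η x)
      (C := p * (|C| / (1 + ‖x‖ ^ ((d : ℝ) + c)))) (fun η hη =>
        ((hC3 x).contDiffAt (hU.mem_nhds (hball hη))).differentiableAt (by norm_num))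
      (fun η hη => norm_fderiv_le_of_partialDeriv fun i =>
        (hb η (hball hη) x 1 (by simp) i).trans (by gcongr; exact le_abs_self C))
      (Metric.mem_ball_self hr₀) hθ'
    rw [Real.norm_eq_abs] at this
    refine this.trans (le_of_eq ?_)
    ring
  refine ⟨min r₀ (ε / (p * |C| * K + 1)), by positivity, fun θ' hθ' n i => ?_⟩
  have h1 : θ' ∈ Metric.ball θ r₀ := Metric.ball_subset_ball (min_le_left _ _) hθ'
  have h2 : ‖θ' - θ‖ * (p * |C| * K + 1) ≤ ε := by
    rw [← le_div_iff₀ (by positivity)]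
    have := Metric.mem_ball.1 (Metric.ball_subset_ball (min_le_right _ _) hθ')
    rw [dist_eq_norm] at this
    exact this.le
  rw [sum_fin_eq s (fun x => |k θ' x - k θ x|)]
  calc _ ≤ ∑ j ∈ Finset.range n, p * |C| * ‖θ' - θ‖ * (1 / (1 + ‖s i - s j‖ ^ ((d : ℝ) + c))) :=
        Finset.sum_le_sum fun j _ => hlip θ' h1 _
    _ ≤ p * |C| * ‖θ' - θ‖ * K := by
        rw [← Finset.mul_sum]; gcongr; exact hsum _ _
    _ ≤ ε := by nlinarith [norm_nonneg (θ' - θ)]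

end CovarianceModel

/-! ### Uniform law of large numbers for quadratic forms -/

section QuadraticForms

open scoped Matrix Matrix.Norms.L2Operator

/-- Observations with second moments `ρ` of constant diagonal `w`, whose products are square
integrable, and for which quadratic forms with uniformly bounded row sums have variance of order `n`. -/
structure QuadraticLLN {Ω : Type*} [MeasurableSpace Ω] (P : Measure Ω) (Y : ℕ → Ω → ℝ)
    (ρ : ℕ → ℕ → ℝ) (w : ℝ) : Prop where
  memLp : ∀ i j, MemLp (fun ω => Y i ω * Y j ω) 2 P
  integral_mul : ∀ i j, ∫ ω, Y i ω * Y j ω ∂P = ρ i j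
  diag : ∀ i, ρ i i = w
  variance_le : ∃ D : ℝ, 0 < D ∧ ∀ (n : ℕ) (A : Matrix (Fin n) (Fin n) ℝ) (K : ℝ), 0 ≤ K →
      A.IsSymm → (∀ i, ∑ j, |A i j| ≤ K) →
      Var[fun ω => ∑ i, ∑ j, A i j * (Y i ω * Y j ω); P] ≤ n * (D * K ^ 2)

/-- The deviation of the quadratic form with matrix `A` from its mean, divided by the dimension, for
observations with second moments `ρ`. -/
noncomputable def quadDeviation (ρ : ℕ → ℕ → ℝ) {n : ℕ} (A : Matrix (Fin n) (Fin n) ℝ)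
    (y : Fin n → ℝ) : ℝ :=
  (1 / (n : ℝ)) * (y ⬝ᵥ A.mulVec y - ∑ i : Fin n, ∑ j : Fin n, A i j * ρ i j)

theorem Matrix.quadForm_eq_sum {n : ℕ} (A : Matrix (Fin n) (Fin n) ℝ) (y : Fin n → ℝ) :
    y ⬝ᵥ A.mulVec y = ∑ i, ∑ j, A i j * (y i * y j) := by
  simp only [dotProduct, Matrix.mulVec, Finset.mul_sum]
  exact Finset.sum_congr rfl fun i _ => Finset.sum_congr rfl fun j _ => by ring

theorem quadDeviation_sub (ρ : ℕ → ℕ → ℝ) {n : ℕ} (A B : Matrix (Fin n) (Fin n) ℝ) (y : Fin n → ℝ) :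
    quadDeviation ρ A y - quadDeviation ρ B y = quadDeviation ρ (A - B) y := by
  simp only [quadDeviation, Matrix.sub_mulVec, dotProduct_sub, Matrix.sub_apply, sub_mul,
    Finset.sum_sub_distrib]
  ring

namespace QuadraticLLN

variable {Ω : Type*} [MeasurableSpace Ω] {P : Measure Ω} {Y : ℕ → Ω → ℝ}
  {ρ : ℕ → ℕ → ℝ} {w : ℝ}

theorem integrable_mul [IsProbabilityMeasure P] (h : QuadraticLLN P Y ρ w) (i j : ℕ) : Integrable (fun ω => Y i ω * Y j ω) P :=
  (h.memLp i j).integrable (by norm_num)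

theorem memLp_quadForm (h : QuadraticLLN P Y ρ w) {n : ℕ} (A : Matrix (Fin n) (Fin n) ℝ) :
    MemLp (fun ω => ∑ i, ∑ j, A i j * (Y i ω * Y j ω)) 2 P :=
  memLp_finsetSum _ fun (i : Fin n) _ => memLp_finsetSum _ fun (j : Fin n) _ =>
    (h.memLp i j).const_mul (A i j)

theorem integral_quadForm [IsProbabilityMeasure P] (h : QuadraticLLN P Y ρ w) {n : ℕ} (A : Matrix (Fin n) (Fin n) ℝ) :
    ∫ ω, ∑ i, ∑ j, A i j * (Y i ω * Y j ω) ∂P = ∑ i : Fin n, ∑ j : Fin n, A i j * ρ i j := by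
  have hi : ∀ i j : Fin n, Integrable (fun ω => A i j * (Y i ω * Y j ω)) P :=
    fun i j => (h.integrable_mul i j).const_mul _
  rw [integral_finsetSum _ fun i _ => integrable_finsetSum _ fun j _ => hi i j]
  refine Finset.sum_congr rfl fun i _ => ?_
  rw [integral_finsetSum _ fun j _ => hi i j]
  refine Finset.sum_congr rfl fun j _ => ?_
  rw [integral_const_mul, h.integral_mul]

/-- Chebyshev's inequality; the variance of the deviation is of order `1 / n`. -/
theorem tendsto_measure_quadDeviation [IsProbabilityMeasure P] (h : QuadraticLLN P Y ρ w)
    (A : ∀ n : ℕ, Matrix (Fin n) (Fin n) ℝ) {K : ℝ} (hK : 0 ≤ K) (hsymm : ∀ n, (A n).IsSymm)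
    (hrow : ∀ n i, ∑ j, |A n i j| ≤ K) {η : ℝ} (hη : 0 < η) :
    Tendsto (fun n => P {ω | η ≤ |quadDeviation ρ (A n) (fun i => Y i ω)|}) atTop (𝓝 0) := by
  obtain ⟨D, hD, hvar⟩ := h.variance_le
  have hlim : Tendsto (fun n : ℕ => ENNReal.ofReal (D * K ^ 2 / η ^ 2 / (n : ℝ))) atTop (𝓝 0) := by
    have h1 := ENNReal.tendsto_ofReal (tendsto_const_div_atTop_nhds_zero_nat (D * K ^ 2 / η ^ 2))
    rwa [ENNReal.ofReal_zero] at h1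
  refine tendsto_of_tendsto_of_tendsto_of_le_of_le' tendsto_const_nhds hlim
    (Eventually.of_forall fun _ => zero_le) ?_
  filter_upwards [eventually_gt_atTop 0] with n hn
  have hn' : (0 : ℝ) < n := by exact_mod_cast hn
  have hset : {ω | η ≤ |quadDeviation ρ (A n) (fun i => Y i ω)|} ⊆
      {ω | n * η ≤ |(∑ i, ∑ j, A n i j * (Y i ω * Y j ω)) -
        ∫ ω, ∑ i, ∑ j, A n i j * (Y i ω * Y j ω) ∂P|} := by
    intro ω hω
    simp only [Set.mem_ofPred_eq, quadDeviation, Matrix.quadForm_eq_sum, abs_mul,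
      abs_of_pos (one_div_pos.2 hn')] at hω ⊢
    rw [h.integral_quadForm]
    rwa [one_div, inv_mul_eq_div, le_div_iff₀ hn', mul_comm] at hω
  refine (measure_mono hset).trans ((meas_ge_le_variance_div_sq (h.memLp_quadForm (A n))
    (by positivity)).trans (ENNReal.ofReal_le_ofReal ?_))
  calc _ ≤ n * (D * K ^ 2) / (n * η) ^ 2 := by
        gcongr; exact hvar n (A n) K hK (hsymm n) (hrow n)
    _ = _ := by field_simp

/-- The mean of the quadratic form, `∑ A i j ρ i j`, is controlled by the mean squared norm. -/
theorem abs_mean_le [IsProbabilityMeasure P] (h : QuadraticLLN P Y ρ w) {n : ℕ} (A : Matrix (Fin n) (Fin n) ℝ) :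
    |∑ i : Fin n, ∑ j : Fin n, A i j * ρ i j| ≤ ‖A‖ * (n * w) := by
  have h1 : ∫ ω, ∑ i : Fin n, Y i ω * Y i ω ∂P = n * w := by
    rw [integral_finsetSum _ fun (i : Fin n) _ => h.integrable_mul i i]
    simp [h.integral_mul, h.diag]
  rw [← h.integral_quadForm, ← h1, ← integral_const_mul, ← Real.norm_eq_abs]
  refine norm_integral_le_of_norm_le
    ((integrable_finsetSum _ fun (i : Fin n) _ => h.integrable_mul i i).const_mul _)
    (Eventually.of_forall fun ω => ?_)
  have h2 := A.abs_quadForm_le (fun i => Y i ω)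
  rw [Matrix.quadForm_eq_sum] at h2
  exact h2

/-- Matrices close in operator norm have close deviations, as long as the squared norm of the
observation vector is not too large. -/
theorem abs_quadDeviation_sub_le [IsProbabilityMeasure P] (h : QuadraticLLN P Y ρ w) {n : ℕ} (hn : 0 < n)
    (A B : Matrix (Fin n) (Fin n) ℝ) (ω : Ω)
    (hω : |quadDeviation ρ (1 : Matrix (Fin n) (Fin n) ℝ) (fun i => Y i ω)| ≤ 1) :
    |quadDeviation ρ A (fun i => Y i ω) - quadDeviation ρ B (fun i => Y i ω)| ≤
      ‖A - B‖ * (2 * w + 1) := by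
  have hn' : (0 : ℝ) < n := by exact_mod_cast hn
  set y : Fin n → ℝ := fun i => Y i ω with hy
  have h1 : y ⬝ᵥ y ≤ n * (w + 1) := by
    have h2 := (abs_le.1 hω).2
    have h3 : ∑ i : Fin n, ∑ j : Fin n, (1 : Matrix (Fin n) (Fin n) ℝ) i j * ρ i j = n * w := by
      simp [Matrix.one_apply, h.diag]
    rw [quadDeviation, h3, Matrix.one_mulVec, one_div, inv_mul_eq_div, div_le_iff₀ hn'] at h2
    linarith
  rw [quadDeviation_sub, quadDeviation, abs_mul, abs_of_pos (one_div_pos.2 hn'), one_div,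
    inv_mul_eq_div, div_le_iff₀ hn']
  calc _ ≤ |y ⬝ᵥ (A - B).mulVec y| + |∑ i : Fin n, ∑ j : Fin n, (A - B) i j * ρ i j| := abs_sub _ _
    _ ≤ ‖A - B‖ * (y ⬝ᵥ y) + ‖A - B‖ * (n * w) :=
        add_le_add ((A - B).abs_quadForm_le y) (h.abs_mean_le _)
    _ ≤ ‖A - B‖ * (n * (w + 1)) + ‖A - B‖ * (n * w) := by gcongr
    _ = _ := by ring

/-- Uniform law of large numbers for the quadratic forms of the inverses of a compact family of
uniformly well-conditioned matrices that depends continuously on the parameter, uniformly in the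
dimension. -/
theorem tendsto_measure_exists_inv [IsProbabilityMeasure P] (h : QuadraticLLN P Y ρ w) {E : Type*} [TopologicalSpace E]
    {Θ : Set E} (hΘ : IsCompact Θ) (R : E → ∀ n : ℕ, Matrix (Fin n) (Fin n) ℝ) {a b : ℝ} (ha : 0 < a)
    (hab : a ≤ b) (hR : ∀ θ ∈ Θ, ∀ n, (R θ n).Coercive a) (hrow : ∀ θ ∈ Θ, ∀ n i, ∑ j, |R θ n i j| ≤ b)
    (hcont : ∀ θ ∈ Θ, ∀ ε > 0, ∃ U ∈ 𝓝 θ, ∀ θ' ∈ U, θ' ∈ Θ → ∀ n, ‖R θ' n - R θ n‖ ≤ ε)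
    {η : ℝ} (hη : 0 < η) :
    Tendsto (fun n => P {ω | ∃ θ ∈ Θ, η ≤ |quadDeviation ρ (R θ n)⁻¹ (fun i => Y i ω)|}) atTop
      (𝓝 0) := by
  have hw : 0 ≤ w := by
    rw [← h.diag 0, ← h.integral_mul]
    exact integral_nonneg fun ω => mul_self_nonneg _
  -- Two approximation errors `ε`, each weighted by `2 * w + 1`, use up `η / 4`.
  set ε := η / (8 * (2 * w + 1)) with hε
  have hε0 : 0 < ε := by positivity
  obtain ⟨K, hK, happ⟩ := exists_approx_inverse ha hab hε0
  have hA : ∀ θ ∈ Θ, ∀ n, ∃ A : Matrix (Fin n) (Fin n) ℝ, A.IsSymm ∧ (∀ i, ∑ j, |A i j| ≤ K) ∧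
      ‖(R θ n)⁻¹ - A‖ ≤ ε := fun θ hθ n => happ n (R θ n) (hR θ hθ n) (hrow θ hθ n)
  choose! A hAsymm hArow hAε using hA
  have hU : ∀ θ ∈ Θ, ∃ U ∈ 𝓝 θ, ∀ θ' ∈ U, θ' ∈ Θ → ∀ n, ‖R θ' n - R θ n‖ ≤ ε * a ^ 2 :=
    fun θ hθ => hcont θ hθ _ (by positivity)
  choose! U hUn hUε using hU
  obtain ⟨t, htΘ, ht⟩ := hΘ.elim_nhds_subcover U hUn
  have hlim : Tendsto (fun n =>
      (∑ θ ∈ t, P {ω | η / 2 ≤ |quadDeviation ρ (A θ n) (fun i => Y i ω)|}) +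
        P {ω | 1 ≤ |quadDeviation ρ (1 : Matrix (Fin n) (Fin n) ℝ) (fun i => Y i ω)|})
      atTop (𝓝 (∑ θ ∈ t, 0 + 0)) := by
    refine Tendsto.add (tendsto_finsetSum _ fun θ hθ => ?_) ?_
    · exact h.tendsto_measure_quadDeviation (A θ) hK (hAsymm θ (htΘ θ hθ)) (hArow θ (htΘ θ hθ))
        (by positivity)
    · exact h.tendsto_measure_quadDeviation (fun n => 1) zero_le_one (fun n => Matrix.isSymm_one)
        (fun n i => (Matrix.sum_abs_one i).le) one_pos
  rw [Finset.sum_const_zero, add_zero] at hlim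
  refine tendsto_of_tendsto_of_tendsto_of_le_of_le' tendsto_const_nhds hlim
    (Eventually.of_forall fun _ => zero_le) ?_
  filter_upwards [eventually_gt_atTop 0] with n hn
  refine le_trans (measure_mono (t := (⋃ θ ∈ t,
    {ω | η / 2 ≤ |quadDeviation ρ (A θ n) (fun i => Y i ω)|}) ∪
      {ω | 1 ≤ |quadDeviation ρ (1 : Matrix (Fin n) (Fin n) ℝ) (fun i => Y i ω)|}) ?_)
    ((measure_union_le _ _).trans (add_le_add_left (measure_biUnion_finset_le _ _) _))
  rintro ω ⟨θ, hθ, hη'⟩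
  by_contra hcon
  simp only [Set.mem_union, Set.mem_iUnion, Set.mem_ofPred_eq, exists_prop, not_or, not_exists, not_and,
    not_le] at hcon
  obtain ⟨hc1, hc2⟩ := hcon
  obtain ⟨θs, hθs, hθU⟩ := Set.mem_iUnion₂.1 (ht hθ)
  have h1 : ‖(R θ n)⁻¹ - (R θs n)⁻¹‖ ≤ ε := by
    calc _ ≤ a⁻¹ * a⁻¹ * ‖R θ n - R θs n‖ :=
          (hR θ hθ n).norm_inv_sub_inv_le (hR θs (htΘ θs hθs) n)
      _ ≤ a⁻¹ * a⁻¹ * (ε * a ^ 2) := by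
          gcongr; exact hUε θs (htΘ θs hθs) θ hθU hθ n
      _ = ε := by field_simp
  have h2 : ‖(R θ n)⁻¹ - A θs n‖ ≤ 2 * ε := by
    calc _ = ‖((R θ n)⁻¹ - (R θs n)⁻¹) + ((R θs n)⁻¹ - A θs n)‖ := by rw [sub_add_sub_cancel]
      _ ≤ ε + ε := (norm_add_le _ _).trans (add_le_add h1 (hAε θs (htΘ θs hθs) n))
      _ = _ := by ring
  have h3 := h.abs_quadDeviation_sub_le hn (R θ n)⁻¹ (A θs n) ω hc2.le
  have h4 := hc1 θs hθs
  have h5 : ‖(R θ n)⁻¹ - A θs n‖ * (2 * w + 1) ≤ η / 4 := by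
    calc _ ≤ 2 * ε * (2 * w + 1) := by gcongr
      _ = η / 4 := by rw [hε]; field_simp; norm_num
  have h6 := abs_sub_abs_le_abs_sub (quadDeviation ρ (R θ n)⁻¹ (fun i => Y i ω))
    (quadDeviation ρ (A θs n) (fun i => Y i ω))
  linarith

end QuadraticLLN

end QuadraticForms

/-! ### Consistency -/

theorem TransformedGaussianSetting.quadraticLLN {d : ℕ} {Ω : Type*} [MeasurableSpace Ω]
    {P : Measure Ω} [IsProbabilityMeasure P] {Z : Space d → Ω → ℝ} {kZ : Space d → ℝ} {T : ℝ → ℝ}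
    {s : ℕ → Space d} (h : TransformedGaussianSetting P Z kZ T s) {k : Space d → ℝ}
    (hk : HasStationaryCovariance P (transformed T Z) k) :
    QuadraticLLN P (fun i => transformed T Z (s i)) (fun i j => k (s i - s j)) (k 0) := by
  obtain ⟨c, hX⟩ := h.exists_gaussianSequence
  obtain ⟨C, hC⟩ := h.transformation.bound
  obtain ⟨C', c', hc', hdecay⟩ := h.covarianceCond.decay
  obtain ⟨L, hL, hsum⟩ := h.wellSeparated.exists_sum_abs_le (C := C') hc'
  obtain ⟨D, hD, hvar⟩ := hX.exists_variance_le h.transformation.contDiff hC (hsum kZ hdecay)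
  have hmem := fun i j => hX.memLp_mul h.transformation.contDiff (fun t => (hC t).1) i j
  have hY : ∀ i, MemLp (transformed T Z (s i)) 2 P := fun i => (hmem i i).2
  refine ⟨fun i j => (hmem i j).1, fun i j => ?_, fun i => by rw [sub_self], D, hD,
    fun n A K hK hsymm hrow => hvar n A K hK hrow fun j => ?_⟩
  · have h1 := hk (s i) (s j)
    rw [covariance_eq_sub (hY i) (hY j), h.transformedZeroMean (s i), zero_mul,
      sub_zero] at h1
    exact h1
  · simpa only [hsymm.apply] using hrow j

/-- The criterion minus its value at `θ₀` is the Gaussian Kullback–Leibler contrast plus the two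
centred fluctuations. -/
theorem gaussianCriterion_sub {d p : ℕ} (k : Param p → Space d → ℝ) (s : ℕ → Space d) {n : ℕ}
    (y : Fin n → ℝ) (θ θ₀ : Param p) (h₀ : (covMatrix (k θ₀) s n).PosDef) :
    gaussianCriterion k s n y θ - gaussianCriterion k s n y θ₀ =
      (1 / (n : ℝ)) * (Real.log (covMatrix (k θ) s n).det - Real.log (covMatrix (k θ₀) s n).det +
        ((covMatrix (k θ) s n)⁻¹ * covMatrix (k θ₀) s n).trace - n) +
      quadDeviation (fun i j => k θ₀ (s i - s j)) (covMatrix (k θ) s n)⁻¹ y -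
      quadDeviation (fun i j => k θ₀ (s i - s j)) (covMatrix (k θ₀) s n)⁻¹ y := by
  have hsymm : ∀ i j : Fin n, k θ₀ (s i - s j) = covMatrix (k θ₀) s n j i := fun i j => by
    have := h₀.isHermitian.apply j i
    simpa [covMatrix_apply] using this
  have htr : ∀ A : Matrix (Fin n) (Fin n) ℝ,
      ∑ i : Fin n, ∑ j : Fin n, A i j * k θ₀ (s i - s j) = (A * covMatrix (k θ₀) s n).trace := by
    intro A
    simp only [Matrix.trace, Matrix.diag_apply, Matrix.mul_apply, hsymm]
  rw [quadDeviation, quadDeviation, htr, htr, Matrix.nonsing_inv_mul _ h₀.det_pos.ne'.isUnit,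
    Matrix.trace_one, Fintype.card_fin, gaussianCriterion, gaussianCriterion]
  ring

section Consistency

open scoped Matrix.Norms.L2Operator

theorem mainTheorem4 {d p : ℕ} {Ω : Type*} [MeasurableSpace Ω] (P : Measure Ω)
    [IsProbabilityMeasure P]
    (Z : Space d → Ω → ℝ) (kZ : Space d → ℝ) (T : ℝ → ℝ) (s : ℕ → Space d)
    (hsetting : TransformedGaussianSetting P Z kZ T s)
    (Θ : Set (Param p)) (hΘ : IsCompact Θ)
    (k : Param p → Space d → ℝ) (hk : ∀ θ ∈ Θ, IsStationaryCovariance (k θ))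
    (hsmooth : SmoothModel Θ k) (hfourier : FourierPositive Θ k)
    (θ₀ : Param p) (hθ₀ : θ₀ ∈ interior Θ)
    (hspecified : HasStationaryCovariance P (transformed T Z) (k θ₀))
    (hident : GloballyIdentifiable Θ k s θ₀)
    (θhat : ℕ → Ω → Param p) (hML : IsGaussianMLE P Θ k (transformed T Z) s θhat) :
    TendstoInMeasure P θhat atTop (fun _ => θ₀) := by
  have hθ₀Θ : θ₀ ∈ Θ := interior_subset hθ₀
  have hsep := hsetting.wellSeparated
  obtain ⟨a, ha, hcoer⟩ := hfourier.exists_quadForm_ge hΘ hk hsep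
  obtain ⟨C, c, hc, hdecay⟩ := hsmooth.decay
  obtain ⟨b₀, hb₀, hrow₀⟩ := hsep.exists_sum_abs_le (C := C) hc
  set b := max a b₀ with hb
  have hab : a ≤ b := le_max_left _ _
  have hbpos : 0 < b := ha.trans_le hab
  have hR : ∀ θ ∈ Θ, ∀ n, (covMatrix (k θ) s n).Coercive a := fun θ hθ n =>
    ⟨(hk θ hθ).isSymm_covMatrix s n, ha, hcoer θ hθ n⟩
  have hrow : ∀ θ ∈ Θ, ∀ n i, ∑ j, |covMatrix (k θ) s n i j| ≤ b := fun θ hθ n i =>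
    (hrow₀ (k θ) (hdecay θ hθ) n i).trans (le_max_right _ _)
  have hnorm : ∀ θ ∈ Θ, ∀ n, ‖covMatrix (k θ) s n‖ ≤ b := fun θ hθ n =>
    (hR θ hθ n).symm.l2_opNorm_le_of_sum_abs_le hbpos.le (hrow θ hθ n)
  have hcont : ∀ θ ∈ Θ, ∀ ε > 0, ∃ U ∈ 𝓝 θ, ∀ θ' ∈ U, θ' ∈ Θ → ∀ n,
      ‖covMatrix (k θ') s n - covMatrix (k θ) s n‖ ≤ ε := by
    intro θ hθ ε hε
    obtain ⟨r, hr, hball⟩ := hsmooth.exists_sum_abs_sub_le hsep hθ hε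
    exact ⟨Metric.ball θ r, Metric.ball_mem_nhds θ hr, fun θ' hθ' hθ'Θ n =>
      ((hR θ' hθ'Θ n).symm.sub (hR θ hθ n).symm).l2_opNorm_le_of_sum_abs_le hε.le (hball θ' hθ' n)⟩
  have hLLN := hsetting.quadraticLLN hspecified
  obtain ⟨c₁, hc₁, hKL⟩ := exists_kullback_ge ha hbpos
  refine tendstoInMeasure_of_ne_top fun ε hε hεtop => ?_
  set α := ε.toReal with hα
  have hαpos : 0 < α := ENNReal.toReal_pos hε.ne' hεtop
  obtain ⟨κ, hκ0, hκ⟩ := EReal.lt_iff_exists_real_btwn.1 (hident α hαpos)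
  have hκpos : 0 < κ := by exact_mod_cast hκ0
  -- The contrast is at least `c₁ * κ` away from `θ₀`, so that two fluctuations below a third of it
  -- exclude a minimizer there.
  have hη : 0 < c₁ * κ / 3 := by positivity
  have hunif := hLLN.tendsto_measure_exists_inv hΘ (fun θ n => covMatrix (k θ) s n) ha hab hR hrow hcont hη
  refine tendsto_of_tendsto_of_tendsto_of_le_of_le' tendsto_const_nhds hunif
    (Eventually.of_forall fun _ => zero_le) ?_
  filter_upwards [eventually_lt_of_lt_liminf hκ, eventually_gt_atTop 0] with n hn hn0
  have hn' : (0 : ℝ) < n := by exact_mod_cast hn0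
  refine measure_mono_ae ?_
  filter_upwards [hML n hn0] with ω hω hmem
  obtain ⟨hθΘ, hmin⟩ := hω
  set θ := θhat n ω with hθ
  have hdist : α ≤ ‖θ - θ₀‖ := by
    have h1 : ε ≤ edist θ θ₀ := hmem
    rw [edist_dist, dist_eq_norm] at h1
    exact ENNReal.toReal_le_of_le_ofReal (norm_nonneg _) h1
  have hfrob : κ < (1 / (n : ℝ)) * ∑ i : Fin n, ∑ j : Fin n,
      (k θ (s i - s j) - k θ₀ (s i - s j)) ^ 2 := by
    have h1 := hn.trans_le (iInf₂_le_of_le θ hθΘ (iInf_le _ hdist))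
    exact_mod_cast h1
  have hcrit := gaussianCriterion_sub k s (observation (transformed T Z) s n ω) θ θ₀
    (hR θ₀ hθ₀Θ n).posDef
  have hle : gaussianCriterion k s n (observation (transformed T Z) s n ω) θ ≤
      gaussianCriterion k s n (observation (transformed T Z) s n ω) θ₀ := hmin hθ₀Θ
  have hcontrast : c₁ * κ ≤ (1 / (n : ℝ)) * (Real.log (covMatrix (k θ) s n).det -
      Real.log (covMatrix (k θ₀) s n).det +
        ((covMatrix (k θ) s n)⁻¹ * covMatrix (k θ₀) s n).trace - n) := by
    have h1 := hKL n _ _ (hR θ hθΘ n) (hR θ₀ hθ₀Θ n) (hnorm θ hθΘ n) (hnorm θ₀ hθ₀Θ n)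
    simp only [covMatrix_apply] at h1
    calc c₁ * κ ≤ c₁ * ((1 / (n : ℝ)) * ∑ i : Fin n, ∑ j : Fin n,
          (k θ (s i - s j) - k θ₀ (s i - s j)) ^ 2) := by gcongr
      _ = (1 / (n : ℝ)) * (c₁ * ∑ i : Fin n, ∑ j : Fin n,
          (k θ (s i - s j) - k θ₀ (s i - s j)) ^ 2) := by ring
      _ ≤ _ := by gcongr
  change ∃ θ ∈ Θ, c₁ * κ / 3 ≤ |quadDeviation (fun i j => k θ₀ (s i - s j)) (covMatrix (k θ) s n)⁻¹
    (observation (transformed T Z) s n ω)|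
  by_contra hcon
  push Not at hcon
  have h1 := (abs_lt.1 (hcon θ hθΘ)).1
  have h2 := (abs_lt.1 (hcon θ₀ hθ₀Θ)).2
  have h3 : 0 < c₁ * κ := by positivity
  linarith

end Consistency
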